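/- **Level-pinching.** A metric graph $\mathcal G$ consists of finitely many vertices and finitely many edges (multiple edges and self-loops are allowed). Each edge $e$ is identified with an interval $I_e$, which is either $[0,\ell_e]$ with $0\le \ell_e<\infty$, both ends being attached to (finite) vertices, or $[0,\infty)$ with only the end $0$ attached to a (finite) vertex; edges of the second kind are called halflines, and each halfline is regarded as ending at its own vertex at infinity. The graph is noncompact if it contains at least one halfline. Let $H^1(\mathcal G)$ be the set of families $u=(u_e)_e$ of continuous functions $u_e:I_e\to\mathbb C$ with $u_e\in H^1(I_e)$ for every $e$, such that the value attained at each finite vertex does not depend on the edge chosen to reach it. For $p>2$ put $$E(u,\mathcal G)=\sum_e\Big(\tfrac12\int_{I_e}|u_e'|^2\,dx-\tfrac1p\int_{I_e}|u_e|^p\,dx\Big),\qquad \mathcal E_{\mathcal G}(\mu)=\inf\Big\{E(v,\mathcal G): v\in H^1(\mathcal G),\ \sum_e\int_{I_e}|v_e|^2\,dx=\mu\Big\}\in[-\infty,\infty].$$ For $p\in(2,6)$ and $\mu>0$ let $\phi_\mu$ be the soliton of mass $\mu$ on the line, $$\phi_\mu(x)=C\,\mu^{\frac2{6-p}}\,\mathrm{sech}^{\frac2{p-2}}\!\big(c\,\mu^{\frac{p-2}{6-p}}x\big),\qquad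 C=\Big(\frac p2\Big)^{\frac1{p-2}}K^{\frac2{6-p}},\quad c=\frac{p-2}2\,K^{\frac{p-2}{6-p}},\quad K=\frac{\frac{p-2}2\big(\frac2p\big)^{\frac2{p-2}}}{\int_{\mathbb R}\mathrm{sech}^{\frac4{p-2}}(y)\,dy},$$ and for $I=\mathbb R$ or $I=\mathbb R^+=[0,\infty)$ write $E(\phi,I)=\frac12\int_I|\phi'|^2\,dx-\frac1p\int_I|\phi|^p\,dx$. Then for every connected noncompact metric graph $\mathcal G$, every $p\in(2,6)$ and every $\mu>0$, $$E(\phi_{2\mu},\mathbb R^+)\ \le\ \mathcal E_{\mathcal G}(\mu)\ \le\ E(\phi_\mu,\mathbb R).$$ -/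

import Mathlib

open MeasureTheory Set
open scoped ENNReal ContDiff

/-- A metric graph with vertex set `V` and edge set `E` (multiple edges and self-loops are allowed).
Some vertices may be at infinity; edges ending at such a vertex are the halflines. An edge `e` is
identified with the interval `[0, length e]` (with `[0, ∞)` if `length e = ∞`), where the
coordinate `0` corresponds to `src e` and the other end to `tgt e`. -/
structure MetricGraph (V E : Type*) where
  /-- The set of vertices at infinity. -/
  atInfinity : Set V
  /-- The vertex at the coordinate `0` of an edge. -/
  src : E → V
  /-- The vertex at the other end of an edge. -/
  tgt : E → V
  /-- The length of an edge. -/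
  length : E → ℝ≥0∞
  /-- Halflines start at a finite vertex; in particular, no edge joins two vertices at infinity. -/
  src_notMem_atInfinity : ∀ e, src e ∉ atInfinity
  /-- Every vertex at infinity has degree one. -/
  degree_atInfinity : ∀ v ∈ atInfinity, ∃! e, tgt e = v
  /-- The edges of infinite length are exactly the halflines. -/
  length_eq_top_iff : ∀ e, length e = ⊤ ↔ tgt e ∈ atInfinity

/-- `g` is the weak derivative of `u` in the interior of the interval `I`. -/
def IsWeakDerivOn (I : Set ℝ) (u g : ℝ → ℂ) : Prop :=
  ∀ η : ℝ → ℝ, ContDiff ℝ ∞ η → HasCompactSupport η → tsupport η ⊆ interior I →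
    ∫ x in I, deriv η x • u x = -∫ x in I, η x • g x

/-- The NLS energy `(1/2) ∫_I |u'|² - (1/p) ∫_I |u|^p` of a function `u` with derivative `u'`
on an interval `I`. -/
noncomputable def energyOn {F : Type*} [NormedAddCommGroup F] (p : ℝ) (I : Set ℝ)
    (u u' : ℝ → F) : ℝ :=
  1 / 2 * (∫ x in I, ‖u' x‖ ^ 2) - 1 / p * ∫ x in I, ‖u x‖ ^ p

namespace MetricGraph

variable {V E : Type*}

/-- The interval `[0, length e]`, or `[0, ∞)` for a halfline. -/
def interval (G : MetricGraph V E) (e : E) : Set ℝ :=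
  {x | 0 ≤ x ∧ ENNReal.ofReal x ≤ G.length e}

theorem interval_of_eq_top (G : MetricGraph V E) {e : E} (h : G.length e = ⊤) :
    G.interval e = Ici 0 := by
  ext x; simp [interval, h]

theorem interval_of_ne_top (G : MetricGraph V E) {e : E} (h : G.length e ≠ ⊤) :
    G.interval e = Icc 0 (G.length e).toReal := by
  ext x; simp [interval, ENNReal.ofReal_le_iff_le_toReal h]

/-- Any two vertices are joined by a chain of edges (traversed in either direction). -/
def Connected (G : MetricGraph V E) : Prop :=
  ∀ v w : V, Relation.EqvGen (fun a b => ∃ e, G.src e = a ∧ G.tgt e = b) v w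

/-- The graph contains at least one halfline. -/
def Noncompact (G : MetricGraph V E) : Prop :=
  G.atInfinity.Nonempty

/-- The elements of `H¹(G)`: continuous functions `u = (u_e)` on the graph (values of `u_e` outside
the interval of `e` are irrelevant) such that `u_e` and its weak derivative belong to `L²` of the
interval, for every edge `e`. The weak derivative, which is unique up to null sets, is recorded. -/
structure H1Function (G : MetricGraph V E) where
  /-- The function on each edge. -/
  toFun : E → ℝ → ℂ
  /-- The weak derivative on each edge. -/
  weakDeriv : E → ℝ → ℂ
  continuousOn : ∀ e, ContinuousOn (toFun e) (G.interval e)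
  /-- Continuity at the vertices: the value does not depend on the edge chosen to reach a vertex
  (there is no condition at the vertices at infinity). -/
  continuous_vertex : ∃ val : V → ℂ, ∀ e, toFun e 0 = val (G.src e) ∧
    (G.length e ≠ ⊤ → toFun e (G.length e).toReal = val (G.tgt e))
  memLp_toFun : ∀ e, MemLp (toFun e) 2 (volume.restrict (G.interval e))
  memLp_weakDeriv : ∀ e, MemLp (weakDeriv e) 2 (volume.restrict (G.interval e))
  isWeakDerivOn : ∀ e, IsWeakDerivOn (G.interval e) (toFun e) (weakDeriv e)

/-- The mass `‖u‖²` in `L²(G)`. -/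
noncomputable def H1Function.mass [Fintype E] {G : MetricGraph V E} (u : G.H1Function) : ℝ :=
  ∑ e, ∫ x in G.interval e, ‖u.toFun e x‖ ^ 2

/-- The NLS energy `E(u, G) = (1/2) ∫_G |u'|² - (1/p) ∫_G |u|^p`. -/
noncomputable def H1Function.energy [Fintype E] {G : MetricGraph V E} (p : ℝ)
    (u : G.H1Function) : ℝ :=
  ∑ e, energyOn p (G.interval e) (u.toFun e) (u.weakDeriv e)

/-- The ground-state energy level: the infimum, in the extended reals, of the energy over all
functions in `H¹(G)` of mass `μ`. -/
noncomputable def groundStateLevel [Fintype E] (G : MetricGraph V E) (p μ : ℝ) : EReal :=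
  ⨅ (u : G.H1Function) (_ : u.mass = μ), (u.energy p : EReal)

end MetricGraph

/-- The auxiliary constant `K = (p-2)/2 * (2/p)^(2/(p-2)) / ∫_ℝ sech^(4/(p-2))`, which makes
the mass of the soliton `soliton p μ` equal to `μ`. -/
noncomputable def solitonConst (p : ℝ) : ℝ :=
  (p - 2) / 2 * (2 / p) ^ (2 / (p - 2)) / ∫ y : ℝ, (1 / Real.cosh y) ^ (4 / (p - 2))

/-- The amplitude constant `C` of the soliton. -/
noncomputable def solitonAmplitude (p : ℝ) : ℝ :=
  (p / 2) ^ (1 / (p - 2)) * solitonConst p ^ (2 / (6 - p))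

/-- The inverse width constant `c` of the soliton. -/
noncomputable def solitonInvWidth (p : ℝ) : ℝ :=
  (p - 2) / 2 * solitonConst p ^ ((p - 2) / (6 - p))

/-- The soliton of mass `μ` on the line,
`φ_μ(x) = C μ^(2/(6-p)) sech^(2/(p-2)) (c μ^((p-2)/(6-p)) x)`: the even positive solution of
`φ'' + φ^(p-1) = ω φ` decaying at infinity, with `ω > 0` such that `∫_ℝ φ² = μ`. -/
noncomputable def soliton (p μ x : ℝ) : ℝ :=
  solitonAmplitude p * μ ^ (2 / (6 - p)) *
    (1 / Real.cosh (solitonInvWidth p * μ ^ ((p - 2) / (6 - p)) * x)) ^ (2 / (p - 2))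

/-! Lower bound. Let `u` have mass `μ` and let `M` be the supremum of `|u|`. The function `F(s) =
(2/p) M^(p-2) s² - (2/p) s^p` is nonnegative on `[0, M]`, and `E(u) + (1/p) M^(p-2) μ` is the
integral over the graph of `(|u'|² + F(|u|)) / 2`, which is at least that of `√F(|u|) |u'|`. By
connectedness, and because `|u|` takes arbitrarily small values on a halfline, `|u|` takes every
value in `(0, M)`. Hence the last integral is at least `∫_0^M √F`, the quantity `halfSolitonAction p
M`. This is a covering argument: the images of the edges under a primitive of `√F` composed with
`|u|` cover an interval. No rearrangement is needed (`exists_halfSolitonAction_le`).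

It remains to minimize `halfSolitonAction p M - (1/p) M^(p-2) μ` over `M`. The action is a constant
times `M^((p+2)/2)`, so with `M = A t`, `A` being the height of the half soliton of mass `μ`, the
claim is Bernoulli's inequality for `t^(p-2)`, with equality at `t = 1`. There the value is the
energy of the half soliton, because its first integral `φ'² = F(φ)` turns every inequality above
into an equality (`energyOn_soliton_le`).

Upper bound. The soliton is translated far out along a halfline, multiplied by a cutoff vanishing at
the origin of that halfline, rescaled to mass `μ` and extended by zero. Its energy tends to that of
the soliton on the line (`groundStateLevel_le_energyOn_soliton`). -/

/-! ### Sech profiles: decay, first integral and integral identities. -/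

/-- The function `A sech(b x)^r`. -/
noncomputable def sechProfile (A b r x : ℝ) : ℝ := A * (1 / Real.cosh (b * x)) ^ r

theorem sech_pos (x : ℝ) : 0 < 1 / Real.cosh x := one_div_pos.2 (Real.cosh_pos x)

theorem sech_le_exp (x : ℝ) : 1 / Real.cosh x ≤ 2 * Real.exp (-|x|) := by
  rw [div_le_iff₀ (Real.cosh_pos x), ← Real.cosh_abs, Real.cosh_eq]
  have : Real.exp (-|x|) * Real.exp |x| = 1 := by rw [← Real.exp_add]; simp
  nlinarith [Real.exp_pos (-|x|)]

theorem integrable_exp_neg_mul_abs {r : ℝ} (hr : 0 < r) :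
    Integrable fun x : ℝ => Real.exp (-r * |x|) := by
  have h := integral_comp_abs (f := fun x => Real.exp (-r * x))
  rw [integral_exp_mul_Ioi (by linarith)] at h
  -- The computed integral is nonzero, whereas a nonintegrable function has integral `0` by
  -- convention.
  by_contra hc
  rw [integral_undef hc] at h
  simp at h
  exact hr.ne' h

theorem integrable_sech_rpow {b r : ℝ} (hb : 0 < b) (hr : 0 < r) :
    Integrable fun x : ℝ => (1 / Real.cosh (b * x)) ^ r := by
  refine ((integrable_exp_neg_mul_abs (mul_pos hr hb)).const_mul (2 ^ r)).mono' ?_ ?_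
  · refine Continuous.aestronglyMeasurable ?_
    refine Continuous.rpow_const ?_ fun x => Or.inl (sech_pos _).ne'
    exact continuous_const.div (by fun_prop) fun x => (Real.cosh_pos _).ne'
  · refine .of_forall fun x => ?_
    rw [Real.norm_of_nonneg (Real.rpow_nonneg (sech_pos _).le _)]
    refine (Real.rpow_le_rpow (sech_pos _).le (sech_le_exp _) hr.le).trans_eq ?_
    rw [Real.mul_rpow (by norm_num) (Real.exp_pos _).le, ← Real.exp_mul, abs_mul, abs_of_pos hb]
    congr 2; ring

theorem sechProfile_pos {A b r : ℝ} (hA : 0 < A) (x : ℝ) : 0 < sechProfile A b r x :=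
  mul_pos hA (Real.rpow_pos_of_pos (sech_pos _) _)

theorem sechProfile_rpow {A b r : ℝ} (hA : 0 < A) (q x : ℝ) :
    sechProfile A b r x ^ q = A ^ q * (1 / Real.cosh (b * x)) ^ (r * q) := by
  rw [sechProfile, Real.mul_rpow hA.le (Real.rpow_nonneg (sech_pos _).le _),
    ← Real.rpow_mul (sech_pos _).le]

theorem integrable_sechProfile_rpow {A b r q : ℝ} (hA : 0 < A) (hb : 0 < b) (hr : 0 < r)
    (hq : 0 < q) : Integrable fun x : ℝ => sechProfile A b r x ^ q := by
  simp_rw [sechProfile_rpow hA]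
  exact (integrable_sech_rpow hb (mul_pos hr hq)).const_mul _

theorem sechProfile_zero (A b r : ℝ) : sechProfile A b r 0 = A := by simp [sechProfile]

theorem sechProfile_neg (A b r x : ℝ) : sechProfile A b r (-x) = sechProfile A b r x := by
  simp [sechProfile]

theorem sechProfile_abs (A b r x : ℝ) : sechProfile A b r |x| = sechProfile A b r x := by
  rcases abs_choice x with h | h <;> rw [h]
  exact sechProfile_neg ..

theorem hasDerivAt_sechProfile (A b r x : ℝ) :
    HasDerivAt (sechProfile A b r)
      (-(r * b * (Real.sinh (b * x) / Real.cosh (b * x)) * sechProfile A b r x)) x := by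
  have h1 : HasDerivAt (fun x => Real.cosh (b * x)) (Real.sinh (b * x) * (b * 1)) x :=
    ((hasDerivAt_id x).const_mul b).cosh
  have h2 := (((h1.inv (Real.cosh_pos _).ne').rpow_const (p := r)
    (Or.inl (inv_pos.2 (Real.cosh_pos _)).ne')).const_mul A)
  refine (h2.congr_of_eventuallyEq (.of_forall fun y => by simp [sechProfile])).congr_deriv ?_
  have hc := Real.cosh_pos (b * x)
  simp only [Pi.inv_apply]
  rw [Real.rpow_sub_one (inv_pos.2 hc).ne', sechProfile, one_div]
  field_simp

theorem continuous_sechProfile (A b r : ℝ) : Continuous (sechProfile A b r) :=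
  continuous_iff_continuousAt.2 fun x => (hasDerivAt_sechProfile A b r x).continuousAt

theorem deriv_sechProfile (A b r : ℝ) : deriv (sechProfile A b r) =
    fun x => -(r * b * (Real.sinh (b * x) / Real.cosh (b * x)) * sechProfile A b r x) :=
  funext fun x => (hasDerivAt_sechProfile A b r x).deriv

theorem continuous_deriv_sechProfile (A b r : ℝ) : Continuous (deriv (sechProfile A b r)) := by
  rw [deriv_sechProfile]
  have h1 : Continuous fun x => Real.sinh (b * x) / Real.cosh (b * x) :=
    Continuous.div (by fun_prop) (by fun_prop) fun x => (Real.cosh_pos _).ne'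
  exact (((continuous_const.mul h1).mul (continuous_sechProfile A b r))).neg

theorem sinh_div_cosh_sq (x : ℝ) : (Real.sinh x / Real.cosh x) ^ 2 = 1 - (1 / Real.cosh x) ^ 2 := by
  have := Real.cosh_sq x
  have := Real.cosh_pos x
  field_simp
  linarith

theorem sinh_div_cosh_abs_le (x : ℝ) : |Real.sinh x / Real.cosh x| ≤ 1 := by
  rw [← sq_le_one_iff_abs_le_one, sinh_div_cosh_sq]
  nlinarith [sech_pos x]

theorem abs_deriv_sechProfile_le {A b r : ℝ} (hA : 0 < A) (hb : 0 < b) (hr : 0 < r) (x : ℝ) :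
    |deriv (sechProfile A b r) x| ≤ r * b * sechProfile A b r x := by
  rw [deriv_sechProfile, abs_neg, abs_mul, abs_mul, abs_of_pos (mul_pos hr hb),
    abs_of_pos (sechProfile_pos hA x), mul_assoc]
  gcongr
  exact mul_le_of_le_one_left (sechProfile_pos hA x).le (sinh_div_cosh_abs_le _)

/-- Since `r (p - 2) = 2`, the factor `sech²` is `(φ / A)^(p-2)`; this is how the nonlinearity `φ^p`
arises from differentiating the profile. -/
theorem sech_sq_mul_sechProfile_sq {A b r p : ℝ} (hA : 0 < A) (hr : r * (p - 2) = 2) (x : ℝ) :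
    A ^ (p - 2) * ((1 / Real.cosh (b * x)) ^ 2 * sechProfile A b r x ^ 2) =
      sechProfile A b r x ^ p := by
  have h : sechProfile A b r x ^ p = sechProfile A b r x ^ (p - 2) * sechProfile A b r x ^ 2 := by
    rw [← Real.rpow_two, ← Real.rpow_add (sechProfile_pos hA x)]; ring_nf
  rw [h, sechProfile_rpow hA (p - 2), hr, Real.rpow_two]
  ring

/-- First integral of the stationary equation. -/
theorem deriv_sechProfile_sq {A b r p : ℝ} (hA : 0 < A) (hr : r * (p - 2) = 2)
    (hb : (r * b) ^ 2 = 2 / p * A ^ (p - 2)) (x : ℝ) :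
    deriv (sechProfile A b r) x ^ 2 =
      2 / p * A ^ (p - 2) * sechProfile A b r x ^ 2 - 2 / p * sechProfile A b r x ^ p := by
  rw [deriv_sechProfile, ← sech_sq_mul_sechProfile_sq hA hr, neg_sq, mul_pow, mul_pow,
    sinh_div_cosh_sq, hb]
  ring

theorem tendsto_sechProfile_atTop (A : ℝ) {b r : ℝ} (hb : 0 < b) (hr : 0 < r) :
    Filter.Tendsto (sechProfile A b r) Filter.atTop (nhds 0) := by
  have h : Filter.Tendsto (fun x => 1 / Real.cosh (b * x)) Filter.atTop (nhds 0) := by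
    have h1 : Filter.Tendsto (fun x : ℝ => 2 * Real.exp (-|b * x|)) Filter.atTop (nhds 0) := by
      have : Filter.Tendsto (fun x : ℝ => |b * x|) Filter.atTop Filter.atTop :=
        Filter.tendsto_abs_atTop_atTop.comp (Filter.tendsto_id.const_mul_atTop hb)
      simpa using (Real.tendsto_exp_neg_atTop_nhds_zero.comp this).const_mul 2
    exact squeeze_zero (fun x => (sech_pos _).le) (fun x => sech_le_exp _) h1
  have h2 := (h.rpow_const (p := r) (Or.inr hr.le)).const_mul A
  rwa [Real.zero_rpow hr.ne', mul_zero] at h2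

theorem integrable_deriv_sechProfile_sq {A b r : ℝ} (hA : 0 < A) (hb : 0 < b) (hr : 0 < r) :
    Integrable fun x => deriv (sechProfile A b r) x ^ 2 := by
  refine ((integrable_sechProfile_rpow hA hb hr zero_lt_two).const_mul ((r * b) ^ 2)).mono'
    ((continuous_deriv_sechProfile A b r).pow 2).aestronglyMeasurable (.of_forall fun x => ?_)
  rw [Real.norm_of_nonneg (sq_nonneg _), Real.rpow_two, ← mul_pow, ← sq_abs]
  gcongr
  exact abs_deriv_sechProfile_le hA hb hr x

section identities

variable {A b r p : ℝ}

theorem integral_deriv_sechProfile_sq (hA : 0 < A) (hb : 0 < b) (hr0 : 0 < r) (hp : 2 < p)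
    (hr : r * (p - 2) = 2) (hrb : (r * b) ^ 2 = 2 / p * A ^ (p - 2)) :
    ∫ x in Ioi 0, deriv (sechProfile A b r) x ^ 2 =
      2 / p * A ^ (p - 2) * (∫ x in Ioi 0, sechProfile A b r x ^ 2) -
        2 / p * ∫ x in Ioi 0, sechProfile A b r x ^ p := by
  have h2 := (integrable_sechProfile_rpow hA hb hr0 zero_lt_two).integrableOn (s := Ioi 0)
  have hpi := (integrable_sechProfile_rpow hA hb hr0 (by linarith : 0 < p)).integrableOn (s := Ioi 0)
  simp_rw [Real.rpow_two] at h2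
  simp_rw [deriv_sechProfile_sq hA hr hrb]
  rw [integral_sub (h2.const_mul _) (hpi.const_mul _), integral_const_mul, integral_const_mul]

/-- The energy identity obtained by testing the stationary equation with the solution. -/
theorem two_mul_integral_deriv_sechProfile_sq (hA : 0 < A) (hb : 0 < b) (hr0 : 0 < r) (hp : 2 < p)
    (hr : r * (p - 2) = 2) (hrb : (r * b) ^ 2 = 2 / p * A ^ (p - 2)) :
    2 * ∫ x in Ioi 0, deriv (sechProfile A b r) x ^ 2 =
      (p - 2) / p * ∫ x in Ioi 0, sechProfile A b r x ^ p := by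
  have hpi := (integrable_sechProfile_rpow hA hb hr0 (by linarith : 0 < p)).integrableOn (s := Ioi 0)
  have hdi := (integrable_deriv_sechProfile_sq hA hb hr0).integrableOn (s := Ioi 0)
  -- With `ω = (r b)²`, the equation `φ'' = ω φ - φ^(p-1)` gives `(φ' φ)' = φ'² + ω φ² - φ^p`, and
  -- the first integral eliminates `ω φ²`. The formula is checked here on the explicit profile. The
  -- boundary terms vanish because `φ'(0) = 0` and `φ` decays.
  have hd : ∀ x, HasDerivAt (fun x => deriv (sechProfile A b r) x * sechProfile A b r x)
      (2 * deriv (sechProfile A b r) x ^ 2 - (p - 2) / p * sechProfile A b r x ^ p) x := by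
    intro x
    have hphi := hasDerivAt_sechProfile A b r x
    have hs : HasDerivAt (fun x => Real.sinh (b * x)) (Real.cosh (b * x) * (b * 1)) x :=
      ((hasDerivAt_id x).const_mul b).sinh
    have hc : HasDerivAt (fun x => Real.cosh (b * x)) (Real.sinh (b * x) * (b * 1)) x :=
      ((hasDerivAt_id x).const_mul b).cosh
    have hc0 := Real.cosh_pos (b * x)
    have h := ((((hs.div hc hc0.ne').const_mul (r * b)).mul hphi).neg).mul hphi
    rw [deriv_sechProfile]
    refine h.congr_deriv ?_
    rw [← sech_sq_mul_sechProfile_sq hA hr]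
    have e : (p - 2) / p * A ^ (p - 2) = r * b ^ 2 := by
      have h3 : (r * b) ^ 2 * (p - 2) = 2 / p * A ^ (p - 2) * (p - 2) := by rw [hrb]
      have h4 : (r * b) ^ 2 * (p - 2) = 2 * (r * b ^ 2) := by linear_combination (r * b ^ 2) * hr
      have h5 : 2 / p * A ^ (p - 2) * (p - 2) = 2 * ((p - 2) / p * A ^ (p - 2)) := by ring
      linarith
    have e2 := Real.cosh_sq (b * x)
    simp only [Pi.mul_apply, Pi.neg_apply, Pi.div_apply]
    rw [← mul_assoc ((p - 2) / p), e]
    field_simp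
    linear_combination (-sechProfile A b r x ^ 2) * e2
  have hbd : Filter.Tendsto (fun x => deriv (sechProfile A b r) x * sechProfile A b r x)
      Filter.atTop (nhds 0) := by
    have h0 := tendsto_sechProfile_atTop A hb hr0
    refine squeeze_zero_norm (a := fun x => r * b * sechProfile A b r x * sechProfile A b r x)
      (fun x => ?_) (by simpa using (h0.const_mul (r * b)).mul h0)
    rw [norm_mul, Real.norm_eq_abs, Real.norm_of_nonneg (sechProfile_pos hA x).le]
    exact mul_le_mul_of_nonneg_right (abs_deriv_sechProfile_le hA hb hr0 x)
      (sechProfile_pos hA x).le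
  have h := integral_Ioi_of_hasDerivAt_of_tendsto' (a := 0) (fun x _ => hd x)
    ((hdi.const_mul 2).sub (hpi.const_mul _)) hbd
  rw [integral_sub (hdi.const_mul 2) (hpi.const_mul _), integral_const_mul, integral_const_mul,
    deriv_sechProfile] at h
  simp only [mul_zero, Real.sinh_zero, zero_div, neg_zero, zero_mul, sub_zero] at h
  simp only [deriv_sechProfile]
  linarith

/-- Integrating `√F(φ) |φ'| = |φ'|²` along the decreasing profile. -/
theorem integral_deriv_sechProfile_sq_eq_intervalIntegral
    (hA : 0 < A) (hb : 0 < b) (hr0 : 0 < r) (hp : 2 < p)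
    (hr : r * (p - 2) = 2) (hrb : (r * b) ^ 2 = 2 / p * A ^ (p - 2)) :
    ∫ x in Ioi 0, deriv (sechProfile A b r) x ^ 2 =
      ∫ s in (0 : ℝ)..A, √(2 / p * A ^ (p - 2) * s ^ 2 - 2 / p * s ^ p) := by
  set h : ℝ → ℝ := fun s => √(2 / p * A ^ (p - 2) * s ^ 2 - 2 / p * s ^ p) with hh
  have hcont : Continuous h := by
    have := Real.continuous_rpow_const (by linarith : 0 ≤ p)
    fun_prop
  have hH : ∀ t, HasDerivAt (fun t => ∫ s in (0 : ℝ)..t, h s) (h t) t := fun t =>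
    intervalIntegral.integral_hasDerivAt_right (hcont.intervalIntegrable _ _)
      hcont.aestronglyMeasurable.stronglyMeasurableAtFilter hcont.continuousAt
  have hd : ∀ x ∈ Ici (0 : ℝ), HasDerivAt (fun x => -∫ s in (0 : ℝ)..sechProfile A b r x, h s)
      (deriv (sechProfile A b r) x ^ 2) x := by
    intro x hx
    have h1 := ((hH _).comp x (hasDerivAt_sechProfile A b r x)).neg
    refine h1.congr_deriv ?_
    -- The first integral makes the radicand `φ'²`, and `φ' ≤ 0` on the halfline fixes the sign of
    -- the root.
    have h2 : h (sechProfile A b r x) = -deriv (sechProfile A b r) x := by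
      rw [hh]
      simp only
      rw [← deriv_sechProfile_sq hA hr hrb, Real.sqrt_sq_eq_abs, abs_of_nonpos]
      rw [deriv_sechProfile]
      have : 0 ≤ Real.sinh (b * x) := Real.sinh_nonneg_iff.2 (mul_nonneg hb.le hx)
      have := Real.cosh_pos (b * x)
      have := sechProfile_pos (b := b) (r := r) hA x
      simp only [Left.neg_nonpos_iff]
      positivity
    rw [h2, deriv_sechProfile]
    ring
  have ht : Filter.Tendsto (fun x => -∫ s in (0 : ℝ)..sechProfile A b r x, h s)
      Filter.atTop (nhds 0) := by
    have h1 : ContinuousAt (fun t => ∫ s in (0 : ℝ)..t, h s) 0 := (hH 0).continuousAt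
    have := (h1.tendsto.comp (tendsto_sechProfile_atTop A hb hr0)).neg
    simpa using this
  have := integral_Ioi_of_hasDerivAt_of_tendsto' hd
    (integrable_deriv_sechProfile_sq hA hb hr0).integrableOn ht
  rw [this, sechProfile_zero]
  ring

end identities

/-! ### Normalization of the soliton. -/

theorem integral_sech_rpow_pos {r : ℝ} (hr : 0 < r) :
    0 < ∫ y : ℝ, (1 / Real.cosh y) ^ r := by
  have hi : Integrable fun y : ℝ => (1 / Real.cosh y) ^ r := by
    simpa using integrable_sech_rpow one_pos hr
  refine (integral_pos_iff_support_of_nonneg (fun y => Real.rpow_nonneg (sech_pos y).le _) hi).2 ?_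
  have : Function.support (fun y : ℝ => (1 / Real.cosh y) ^ r) = univ :=
    eq_univ_of_forall fun y => (Real.rpow_pos_of_pos (sech_pos y) r).ne'
  rw [this]; simp

theorem solitonConst_pos {p : ℝ} (hp : 2 < p) : 0 < solitonConst p := by
  have h1 : 0 < p - 2 := by linarith
  have h2 : 0 < p := by linarith
  have h3 := integral_sech_rpow_pos (r := 4 / (p - 2)) (by positivity)
  unfold solitonConst
  positivity

/-- The soliton as a `sech` profile, with the relations between amplitude, width and mass. -/
theorem exists_soliton_eq_sechProfile {p m : ℝ} (hp : 2 < p) (hp6 : p < 6) (hm : 0 < m) :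
    ∃ A b : ℝ, 0 < A ∧ 0 < b ∧ soliton p m = sechProfile A b (2 / (p - 2)) ∧
      (2 / (p - 2) * b) ^ 2 = 2 / p * A ^ (p - 2) ∧ ∫ x, soliton p m x ^ 2 = m := by
  have h1 : 0 < p - 2 := by linarith
  have h2 : 0 < p := by linarith
  have h6 : 0 < 6 - p := by linarith
  have hK := solitonConst_pos hp
  set K := solitonConst p with hKdef
  -- In both amplitude and width, `K` and `m` carry equal exponents, so everything is a power of the
  -- single parameter `k`.
  set k : ℝ := (K * m) ^ (1 / (6 - p)) with hk
  have hk0 : 0 < k := Real.rpow_pos_of_pos (mul_pos hK hm) _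
  have hkpow : ∀ q : ℝ, K ^ (q / (6 - p)) * m ^ (q / (6 - p)) = k ^ q := by
    intro q
    rw [hk, ← Real.rpow_mul (mul_pos hK hm).le, Real.mul_rpow hK.le hm.le]
    congr 2 <;> ring
  set A := solitonAmplitude p * m ^ (2 / (6 - p)) with hA
  set b := solitonInvWidth p * m ^ ((p - 2) / (6 - p)) with hb
  have hA' : A = (p / 2) ^ (1 / (p - 2)) * k ^ (2 : ℝ) := by
    rw [hA, solitonAmplitude, mul_assoc, ← hKdef, hkpow]
  have hb' : b = (p - 2) / 2 * k ^ (p - 2) := by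
    rw [hb, solitonInvWidth, mul_assoc, ← hKdef, hkpow]
  have hA0 : 0 < A := by rw [hA']; positivity
  have hb0 : 0 < b := by rw [hb']; positivity
  have hs : soliton p m = sechProfile A b (2 / (p - 2)) := rfl
  refine ⟨A, b, hA0, hb0, hs, ?_, ?_⟩
  · have : A ^ (p - 2) = p / 2 * k ^ (2 * (p - 2)) := by
      rw [hA', Real.mul_rpow (by positivity) (by positivity), ← Real.rpow_mul (by positivity),
        ← Real.rpow_mul hk0.le, one_div_mul_cancel h1.ne', Real.rpow_one]
    rw [this, hb', mul_comm 2 (p - 2), Real.rpow_mul hk0.le, Real.rpow_two]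
    field_simp
  · rw [hs]
    have : ∀ x, sechProfile A b (2 / (p - 2)) x ^ 2 =
        A ^ 2 * (fun y => (1 / Real.cosh y) ^ (4 / (p - 2))) (b * x) := by
      intro x
      rw [← Real.rpow_two, sechProfile_rpow hA0, Real.rpow_two]
      congr 2; ring
    simp_rw [this]
    rw [integral_const_mul, Measure.integral_comp_mul_left
      (fun y => (1 / Real.cosh y) ^ (4 / (p - 2))), abs_of_pos (inv_pos.2 hb0), smul_eq_mul]
    set J := ∫ y : ℝ, (1 / Real.cosh y) ^ (4 / (p - 2)) with hJ
    have hJ0 : 0 < J := integral_sech_rpow_pos (by positivity)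
    have hKJ : K * J = (p - 2) / 2 * (2 / p) ^ (2 / (p - 2)) := by
      rw [hKdef, solitonConst, ← hJ, div_mul_cancel₀ _ hJ0.ne']
    -- The mass is `A² J / b`. Splitting `k^4 = k^(p-2) k^(6-p)` cancels the width and leaves
    -- `k^(6-p) = K m`.
    have hA2 : A ^ 2 = (p / 2) ^ (2 / (p - 2)) * (k ^ (p - 2) * (K * m)) := by
      have e1 : k ^ (p - 2) * (K * m) = k ^ (4 : ℝ) := by
        have : K * m = k ^ (6 - p) := by
          rw [hk, ← Real.rpow_mul (mul_pos hK hm).le, one_div_mul_cancel h6.ne', Real.rpow_one]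
        rw [this, ← Real.rpow_add hk0]
        ring_nf
      rw [e1, hA', mul_pow, ← Real.rpow_natCast, ← Real.rpow_natCast, ← Real.rpow_mul (by positivity),
        ← Real.rpow_mul hk0.le]
      congr 2
      · push_cast; ring
      · norm_num
    have hpp : (p / 2) ^ (2 / (p - 2)) * (2 / p) ^ (2 / (p - 2)) = 1 := by
      rw [← Real.mul_rpow (by positivity) (by positivity)]
      have : p / 2 * (2 / p) = 1 := by field_simp
      rw [this, Real.one_rpow]
    have hkp : 0 < k ^ (p - 2) := by positivity
    calc A ^ 2 * (b⁻¹ * J) = (p / 2) ^ (2 / (p - 2)) * (K * J) * m * (k ^ (p - 2) * b⁻¹) := by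
          rw [hA2]; ring
      _ = ((p / 2) ^ (2 / (p - 2)) * (2 / p) ^ (2 / (p - 2))) * m := by
          rw [hKJ, hb']; field_simp
      _ = m := by rw [hpp, one_mul]

/-! ### The half-soliton action and its optimal height. -/

/-- The integral of `√(ω s² - (2/p) s^p)` from `0` to the first positive zero `M` of the radicand;
it is the action of the half soliton of height `M`. -/
noncomputable def halfSolitonAction (p M : ℝ) : ℝ :=
  ∫ s in (0 : ℝ)..M, √(2 / p * M ^ (p - 2) * s ^ 2 - 2 / p * s ^ p)

/-- Under `s ↦ M s` the square root scales by `M^(p/2)` and `ds` by `M`. -/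
theorem halfSolitonAction_eq {p M : ℝ} (hM : 0 < M) :
    halfSolitonAction p M = M ^ ((p + 2) / 2) * halfSolitonAction p 1 := by
  have h := intervalIntegral.mul_integral_comp_mul_left (a := 0) (b := 1) (c := M)
    (f := fun s => √(2 / p * M ^ (p - 2) * s ^ 2 - 2 / p * s ^ p))
  rw [mul_zero, mul_one] at h
  rw [halfSolitonAction, ← h, halfSolitonAction]
  have e : ∀ s ∈ uIcc (0 : ℝ) 1,
      √(2 / p * M ^ (p - 2) * (M * s) ^ 2 - 2 / p * (M * s) ^ p) =
        M ^ (p / 2) * √(2 / p * 1 ^ (p - 2) * s ^ 2 - 2 / p * s ^ p) := by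
    intro s hs
    rw [uIcc_of_le zero_le_one] at hs
    have h1 : M ^ (p - 2) * M ^ 2 = M ^ p := by
      rw [← Real.rpow_two, ← Real.rpow_add hM]; ring_nf
    have h2 : M ^ (p / 2) = √(M ^ p) := by
      rw [Real.sqrt_eq_rpow, ← Real.rpow_mul hM.le]; ring_nf
    rw [h2, ← Real.sqrt_mul (by positivity), Real.mul_rpow hM.le hs.1, Real.one_rpow]
    congr 1
    linear_combination (2 / p * s ^ 2) * h1
  rw [intervalIntegral.integral_congr e, intervalIntegral.integral_const_mul, ← mul_assoc]
  congr 1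
  rw [mul_comm, ← Real.rpow_add_one hM.ne']
  ring_nf

/-- The energy of the half soliton of mass `μ` bounds from below the affine functions
`action - ω μ / 2` for all heights. -/
theorem energyOn_soliton_le {p μ M : ℝ} (hp : 2 < p) (hp6 : p < 6) (hμ : 0 < μ) (hM : 0 < M) :
    energyOn p (Ici 0) (soliton p (2 * μ)) (deriv (soliton p (2 * μ))) ≤
      halfSolitonAction p M - 1 / p * M ^ (p - 2) * μ := by
  obtain ⟨A, b, hA, hb, hs, hrb, hmass⟩ :=
    exists_soliton_eq_sechProfile hp hp6 (mul_pos two_pos hμ)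
  have h1 : 0 < p - 2 := by linarith
  have h0 : 0 < p := by linarith
  have hr0 : 0 < 2 / (p - 2) := by positivity
  have hr : 2 / (p - 2) * (p - 2) = 2 := by field_simp
  -- Three relations between the kinetic integral, `∫ φ^p`, the mass and the action; they express
  -- all terms through `W = A^(p-2) μ`.
  have hT1 := integral_deriv_sechProfile_sq hA hb hr0 hp hr hrb
  have hT2 := two_mul_integral_deriv_sechProfile_sq hA hb hr0 hp hr hrb
  have hT3 := integral_deriv_sechProfile_sq_eq_intervalIntegral hA hb hr0 hp hr hrb
  change _ = halfSolitonAction p A at hT3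
  have hm : ∫ x in Ioi 0, sechProfile A b (2 / (p - 2)) x ^ 2 = μ := by
    have := integral_comp_abs (f := fun x => sechProfile A b (2 / (p - 2)) x ^ 2)
    simp_rw [sechProfile_abs] at this
    rw [← hs, hmass] at this
    rw [← hs]; linarith
  have hE : energyOn p (Ici 0) (soliton p (2 * μ)) (deriv (soliton p (2 * μ))) =
      1 / 2 * (∫ x in Ioi 0, deriv (sechProfile A b (2 / (p - 2))) x ^ 2) -
        1 / p * ∫ x in Ioi 0, sechProfile A b (2 / (p - 2)) x ^ p := by
    rw [energyOn, integral_Ici_eq_integral_Ioi, integral_Ici_eq_integral_Ioi, hs]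
    simp_rw [Real.norm_eq_abs, sq_abs, abs_of_pos (sechProfile_pos hA _)]
  rw [hE, hT3]
  rw [hT3] at hT1 hT2
  rw [hm] at hT1
  set P := ∫ x in Ioi 0, sechProfile A b (2 / (p - 2)) x ^ p
  set T := halfSolitonAction p A
  obtain ⟨t, ht, rfl⟩ : ∃ t, 0 < t ∧ M = A * t := ⟨M / A, by positivity, by field_simp⟩
  have hTM : halfSolitonAction p (A * t) = t ^ ((p + 2) / 2) * T := by
    simp only [T]
    rw [halfSolitonAction_eq hM, halfSolitonAction_eq hA, Real.mul_rpow hA.le ht.le]; ring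
  set W := A ^ (p - 2) * μ with hW
  have hW0 : 0 < W := by positivity
  have hP : P = 2 * p / (p - 2) * T := by
    field_simp; field_simp at hT2; linarith
  have hTW : T = 2 / p * ((p - 2) / (p + 2)) * W := by
    rw [hP] at hT1
    field_simp at hT1 ⊢
    linarith
  -- Bernoulli's inequality, the tangent line at `t = 1` in the variable `t^(p-2)`. The exponent
  -- `(p+2) / (2(p-2))` is at least `1` exactly when `p ≤ 6`.
  have hbern := one_add_mul_self_le_rpow_one_add (s := t ^ (p - 2) - 1)
    (by have : 0 < t ^ (p - 2) := by positivity
        linarith) (p := (p + 2) / (2 * (p - 2)))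
    (by rw [le_div_iff₀ (by positivity)]; linarith)
  rw [add_sub_cancel, ← Real.rpow_mul ht.le] at hbern
  have e : (p - 2) * ((p + 2) / (2 * (p - 2))) = (p + 2) / 2 := by field_simp
  rw [e] at hbern
  rw [hTM, hP, Real.mul_rpow hA.le ht.le, hTW]
  have h4 : 0 < 2 / p * ((p - 2) / (p + 2)) * W := by positivity
  have h5 := mul_le_mul_of_nonneg_left hbern h4.le
  have e1 : 2 / p * ((p - 2) / (p + 2)) * W * (1 + (p + 2) / (2 * (p - 2)) * (t ^ (p - 2) - 1)) =
      2 / p * ((p - 2) / (p + 2)) * W + 1 / p * W * (t ^ (p - 2) - 1) := by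
    field_simp
  have e2 : 1 / 2 * (2 / p * ((p - 2) / (p + 2)) * W) -
      1 / p * (2 * p / (p - 2) * (2 / p * ((p - 2) / (p + 2)) * W)) =
      2 / p * ((p - 2) / (p + 2)) * W - 1 / p * W := by
    field_simp; ring
  rw [e1] at h5
  rw [e2]
  have e3 : 1 / p * (A ^ (p - 2) * t ^ (p - 2)) * μ = 1 / p * W * t ^ (p - 2) := by rw [hW]; ring
  rw [e3]
  linarith

/-! ### A chain-rule inequality for increments bounded by an integral. -/

section chain

variable {w g h : ℝ → ℝ} {a b : ℝ}

theorem AbsolutelyContinuousOnInterval.of_dist_le {X Y : Type*} [PseudoMetricSpace X]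
    [PseudoMetricSpace Y] {G : ℝ → Y} {f : ℝ → X} {C : ℝ}
    (hG : AbsolutelyContinuousOnInterval G a b)
    (h : ∀ s ∈ uIcc a b, ∀ t ∈ uIcc a b, dist (f s) (f t) ≤ C * dist (G s) (G t)) :
    AbsolutelyContinuousOnInterval f a b := by
  refine squeeze_zero' (g := fun E : ℕ × (ℕ → ℝ × ℝ) =>
      C * ∑ i ∈ Finset.range E.1, dist (G (E.2 i).1) (G (E.2 i).2))
    (.of_forall fun E => Finset.sum_nonneg fun i _ => dist_nonneg) ?_
    (by simpa using Filter.Tendsto.const_mul C hG)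
  refine Filter.eventually_inf_principal.2 (.of_forall fun E hE => ?_)
  rw [Finset.mul_sum]
  exact Finset.sum_le_sum fun i hi => h _ (hE.1 i hi).1 _ (hE.1 i hi).2

theorem abs_deriv_le_of_abs_sub_le {w G : ℝ → ℝ} {x w' G' : ℝ} (hw : HasDerivAt w w' x)
    (hG : HasDerivAt G G' x) (h : ∀ᶠ y in nhds x, |w y - w x| ≤ |G y - G x|) : |w'| ≤ |G'| := by
  refine le_of_tendsto_of_tendsto (hasDerivAt_iff_tendsto_slope.1 hw).abs
    (hasDerivAt_iff_tendsto_slope.1 hG).abs ?_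
  filter_upwards [h.filter_mono nhdsWithin_le_nhds] with y hy
  rw [slope_def_field, slope_def_field, abs_div, abs_div]
  gcongr

/-- If the increments of `w` are bounded by the integral of `g`, then the increments of `H ∘ w`,
with `H' = h`, are bounded by the integral of `(h ∘ w) g`. -/
theorem abs_intervalIntegral_le_of_abs_sub_le (hab : a ≤ b) (hg : IntervalIntegrable g volume a b)
    (hg0 : ∀ x, 0 ≤ g x)
    (hw : ∀ s ∈ Icc a b, ∀ t ∈ Icc a b, s ≤ t → |w t - w s| ≤ ∫ x in s..t, g x)
    (hh : Continuous h) (h0 : ∀ s, 0 ≤ h s) :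
    |∫ s in w a..w b, h s| ≤ ∫ x in a..b, h (w x) * g x := by
  set G : ℝ → ℝ := fun x => ∫ t in a..x, g t with hGdef
  have hGac : AbsolutelyContinuousOnInterval G a b :=
    hg.absolutelyContinuousOnInterval_intervalIntegral left_mem_uIcc
  have hsub : ∀ s ∈ Icc a b, IntervalIntegrable g volume a s := fun s hs =>
    hg.mono_set (by rw [uIcc_of_le hab, uIcc_of_le hs.1]; exact Icc_subset_Icc_right hs.2)
  have hGsub : ∀ s ∈ Icc a b, ∀ t ∈ Icc a b, G t - G s = ∫ x in s..t, g x := fun s hs t ht =>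
    intervalIntegral.integral_interval_sub_left (hsub t ht) (hsub s hs)
  have hwG : ∀ s ∈ Icc a b, ∀ t ∈ Icc a b, |w t - w s| ≤ |G t - G s| := by
    intro s hs t ht
    rcases le_total s t with hst | hst
    · rw [hGsub s hs t ht]
      exact (hw s hs t ht hst).trans (le_abs_self _)
    · rw [abs_sub_comm, abs_sub_comm (G t), hGsub t ht s hs]
      exact (hw t ht s hs hst).trans (le_abs_self _)
  -- The increments of `w` are dominated by those of the absolutely continuous `G`, so `w` is
  -- differentiable almost everywhere with `|w'| ≤ g`.
  have hwac : AbsolutelyContinuousOnInterval w a b := by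
    refine hGac.of_dist_le (C := 1) fun s hs t ht => ?_
    rw [uIcc_of_le hab] at hs ht
    simpa [Real.dist_eq, abs_sub_comm] using hwG s hs t ht
  have hwcont : ContinuousOn w (Icc a b) := by simpa [uIcc_of_le hab] using hwac.continuousOn
  obtain ⟨B, hB⟩ := isCompact_Icc.exists_bound_of_continuousOn hwcont
  obtain ⟨C, hC⟩ := (isCompact_Icc (a := -B) (b := B)).exists_bound_of_continuousOn
    hh.continuousOn
  set H : ℝ → ℝ := fun t => ∫ s in (0 : ℝ)..t, h s with hHdef
  have hH : ∀ t, HasDerivAt H (h t) t := fun t =>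
    intervalIntegral.integral_hasDerivAt_right (hh.intervalIntegrable _ _)
      hh.aestronglyMeasurable.stronglyMeasurableAtFilter hh.continuousAt
  have hHsub : ∀ s t, H t - H s = ∫ x in s..t, h x := fun s t =>
    intervalIntegral.integral_interval_sub_left (hh.intervalIntegrable _ _)
      (hh.intervalIntegrable _ _)
  -- `H` is `C`-Lipschitz on an interval containing the range of `w`.
  have hHwac : AbsolutelyContinuousOnInterval (fun x => H (w x)) a b := by
    refine hwac.of_dist_le (C := C) fun s hs t ht => ?_
    rw [uIcc_of_le hab] at hs ht
    rw [dist_comm, dist_comm (w s), Real.dist_eq, Real.dist_eq, hHsub]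
    refine intervalIntegral.norm_integral_le_of_norm_le_const fun x hx => hC x ?_
    have hs' := abs_le.1 (hB s hs)
    have ht' := abs_le.1 (hB t ht)
    exact (uIcc_subset_Icc (a₁ := w s) (b₁ := w t) hs' ht') (uIoc_subset_uIcc hx)
  rw [← hHsub, ← hHwac.integral_deriv_eq_sub]
  refine (intervalIntegral.abs_integral_le_integral_abs hab).trans ?_
  have hhw : ContinuousOn (fun x => h (w x)) (uIcc a b) := by
    rw [uIcc_of_le hab]; exact hh.comp_continuousOn hwcont
  refine intervalIntegral.integral_mono_ae_restrict hab hHwac.intervalIntegrable_deriv.abs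
    (hg.continuousOn_mul hhw) ?_
  have hae : ∀ᵐ x, x ∈ Ioo a b → |deriv (fun x => H (w x)) x| ≤ h (w x) * g x := by
    filter_upwards [hwac.ae_differentiableAt, hg.ae_hasDerivAt_integral] with x hx1 hx2 hx
    have hxu : x ∈ uIcc a b := by rw [uIcc_of_le hab]; exact Ioo_subset_Icc_self hx
    have hd1 := (hx1 hxu).hasDerivAt
    have hd2 := hx2 hxu a left_mem_uIcc
    have hle : |deriv w x| ≤ |g x| := by
      refine abs_deriv_le_of_abs_sub_le hd1 hd2 ?_
      filter_upwards [Icc_mem_nhds hx.1 hx.2] with y hy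
      exact hwG x (Ioo_subset_Icc_self hx) y hy
    have hd3 : deriv (fun x => H (w x)) x = h (w x) * deriv w x := ((hH _).comp x hd1).deriv
    rw [hd3, abs_mul, abs_of_nonneg (h0 _)]
    exact mul_le_mul_of_nonneg_left (hle.trans_eq (abs_of_nonneg (hg0 x))) (h0 _)
  rw [Filter.EventuallyLE, ← restrict_Ioo_eq_restrict_Icc, ae_restrict_iff' measurableSet_Ioo]
  exact hae

end chain

/-! ### From weak derivatives to the fundamental theorem of calculus. -/

section weak

open Filter Topology

theorem tendsto_integral_normed_bump_smul {φ : ℕ → ContDiffBump (0 : ℝ)}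
    (hφ : Tendsto (fun n => (φ n).rOut) atTop (𝓝 0)) {u : ℝ → ℂ} (hu : Continuous u) (x : ℝ) :
    Tendsto (fun n => ∫ t, (φ n).normed volume (t - x) • u t) atTop (𝓝 (u x)) := by
  refine (ContDiffBump.convolution_tendsto_right_of_continuous (μ := volume) hφ hu x).congr
    fun n => ?_
  rw [convolution_eq_swap]
  refine integral_congr_ae (.of_forall fun t => ?_)
  simp only [ContinuousLinearMap.lsmul_apply]
  rw [← (φ n).normed_neg, neg_sub]

/-- The primitive, vanishing at `-∞`, of a normalized bump function. -/
noncomputable def ContDiffBump.primitive (φ : ContDiffBump (0 : ℝ)) (t : ℝ) : ℝ :=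
  ∫ s in (-φ.rOut)..t, φ.normed volume s

namespace ContDiffBump

variable (φ : ContDiffBump (0 : ℝ))

theorem hasDerivAt_primitive (t : ℝ) : HasDerivAt φ.primitive (φ.normed volume t) t :=
  intervalIntegral.integral_hasDerivAt_right (φ.continuous_normed.intervalIntegrable _ _)
    φ.continuous_normed.aestronglyMeasurable.stronglyMeasurableAtFilter
    φ.continuous_normed.continuousAt

theorem contDiff_primitive : ContDiff ℝ ∞ φ.primitive := by
  refine contDiff_infty_iff_deriv.2 ⟨fun t => (φ.hasDerivAt_primitive t).differentiableAt, ?_⟩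
  rw [funext fun t => (φ.hasDerivAt_primitive t).deriv]
  exact φ.contDiff_normed

theorem normed_eq_zero {s : ℝ} (hs : φ.rOut ≤ |s|) : φ.normed volume s = 0 := by
  rw [← Function.notMem_support, φ.support_normed_eq]
  simpa using hs

theorem primitive_of_le {t : ℝ} (ht : t ≤ -φ.rOut) : φ.primitive t = 0 := by
  rw [primitive, intervalIntegral.integral_congr (g := fun _ => 0)]
  · simp
  · intro s hs
    rw [uIcc_of_ge ht] at hs
    refine φ.normed_eq_zero ?_
    rw [abs_of_nonpos (hs.2.trans (by linarith [φ.rOut_pos]))]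
    linarith [hs.2]

theorem primitive_of_ge {t : ℝ} (ht : φ.rOut ≤ t) : φ.primitive t = 1 := by
  have h := φ.rOut_pos
  rw [primitive, intervalIntegral.integral_of_le (by linarith), ← φ.integral_normed (μ := volume)]
  refine setIntegral_eq_integral_of_forall_compl_eq_zero fun s hs => φ.normed_eq_zero ?_
  by_contra hc
  rw [not_le, abs_lt] at hc
  exact hs ⟨hc.1, by linarith⟩

theorem monotone_primitive : Monotone φ.primitive :=
  monotone_of_hasDerivAt_nonneg φ.hasDerivAt_primitive fun t => φ.nonneg_normed t

theorem primitive_mem_Icc (t : ℝ) : φ.primitive t ∈ Icc (0 : ℝ) 1 := by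
  constructor
  · rw [← φ.primitive_of_le (min_le_left (-φ.rOut) t)]
    exact φ.monotone_primitive (min_le_right _ _)
  · rw [← φ.primitive_of_ge (le_max_left φ.rOut t)]
    exact φ.monotone_primitive (le_max_right _ _)

end ContDiffBump

theorem integrable_normed_bump_smul (φ : ContDiffBump (0 : ℝ)) {u : ℝ → ℂ} (hu : Continuous u)
    (x : ℝ) : Integrable fun t => φ.normed volume (t - x) • u t := by
  have hc : Continuous fun t => φ.normed volume (t - x) :=
    φ.continuous_normed.comp (continuous_id.sub continuous_const)
  have hs : HasCompactSupport fun t => φ.normed volume (t - x) :=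
    φ.hasCompactSupport_normed.comp_homeomorph (Homeomorph.subRight x)
  exact Continuous.integrable_of_hasCompactSupport (hc.smul hu) hs.smul_right

theorem exists_seq_contDiffBump {δ : ℝ} (hδ : 0 < δ) : ∃ φ : ℕ → ContDiffBump (0 : ℝ),
    Tendsto (fun n => (φ n).rOut) atTop (𝓝 0) ∧ ∀ n, (φ n).rOut ≤ δ := by
  refine ⟨fun n => ⟨δ / (n + 2), δ / (n + 1), by positivity, by gcongr; norm_num⟩, ?_, fun n =>
    div_le_self hδ.le (by linarith [(Nat.cast_nonneg n : (0 : ℝ) ≤ n)])⟩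
  have := (tendsto_one_div_add_atTop_nhds_zero_nat (𝕜 := ℝ)).const_mul δ
  rw [mul_zero] at this
  exact this.congr fun n => by simp [div_eq_mul_inv]

/-- A function with a locally integrable weak derivative is the integral of it. -/
theorem IsWeakDerivOn.sub_eq_integral {I : Set ℝ} {u g : ℝ → ℂ} (h : IsWeakDerivOn I u g)
    (hI : I.OrdConnected) (hu : ContinuousOn u I)
    (hg : ∀ a b, Icc a b ⊆ I → IntegrableOn g (Icc a b)) {x y : ℝ} (hxy : x ≤ y)
    (hx : x ∈ interior I) (hy : y ∈ interior I) : u y - u x = ∫ t in x..y, g t := by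
  obtain ⟨δ, hδ, hsub⟩ : ∃ δ > 0, Icc (x - δ) (y + δ) ⊆ interior I := by
    obtain ⟨d1, hd1, h1⟩ := Metric.isOpen_iff.1 isOpen_interior x hx
    obtain ⟨d2, hd2, h2⟩ := Metric.isOpen_iff.1 isOpen_interior y hy
    refine ⟨min d1 d2 / 2, by positivity, ?_⟩
    have hm := lt_min hd1 hd2
    refine hI.interior.out (h1 ?_) (h2 ?_)
    · rw [Metric.mem_ball, Real.dist_eq, sub_sub_cancel_left, abs_neg, abs_of_pos (by positivity)]
      linarith [min_le_left d1 d2]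
    · rw [Metric.mem_ball, Real.dist_eq, add_sub_cancel_left, abs_of_pos (by positivity)]
      linarith [min_le_right d1 d2]
  set K := Icc (x - δ) (y + δ) with hK
  have hKI : K ⊆ I := hsub.trans interior_subset
  have hle : x - δ ≤ y + δ := by linarith
  -- `u` and `g` are extended from `K` to the line, so that mollification can be used on `ℝ`; the
  -- test functions below vanish off `K`.
  set u1 : ℝ → ℂ := IccExtend hle (K.domRestrict u) with hu1
  have hu1c : Continuous u1 := (hu.mono hKI).domRestrict.Icc_extend'
  have hu1e : ∀ t ∈ K, u1 t = u t := fun t ht => IccExtend_of_mem hle _ ht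
  set g1 : ℝ → ℂ := K.indicator g with hg1
  have hg1i : Integrable g1 := (integrable_indicator_iff measurableSet_Icc).2 (hg _ _ hKI)
  obtain ⟨φ, hφ, hφδ⟩ := exists_seq_contDiffBump hδ
  -- A smooth approximation of the indicator of `(x, y]`: its derivative is a mollifier at `x` minus
  -- one at `y`, so the weak identity tends to `u x - u y = -∫ g`.
  let η : ℕ → ℝ → ℝ := fun n t => (φ n).primitive (t - x) - (φ n).primitive (t - y)
  have hη0 : ∀ n, ∀ t ∉ K, η n t = 0 := by
    intro n t ht
    have hr := hφδ n
    rcases lt_or_ge t (x - δ) with h1 | h1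
    · simp only [η]
      rw [ContDiffBump.primitive_of_le _ (by linarith), ContDiffBump.primitive_of_le _ (by linarith),
        sub_zero]
    · have h2 : y + δ < t := by
        by_contra hc
        exact ht ⟨h1, not_lt.1 hc⟩
      simp only [η]
      rw [ContDiffBump.primitive_of_ge _ (by linarith), ContDiffBump.primitive_of_ge _ (by linarith),
        sub_self]
  have hηd : ∀ n t, HasDerivAt (η n)
      ((φ n).normed volume (t - x) - (φ n).normed volume (t - y)) t := fun n t =>
    (((φ n).hasDerivAt_primitive (t - x)).comp_sub_const t x).sub
      (((φ n).hasDerivAt_primitive (t - y)).comp_sub_const t y)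
  have hts : ∀ n, tsupport (η n) ⊆ K := fun n =>
    closure_minimal (fun t ht => by_contra fun hc => ht (hη0 n t hc)) isClosed_Icc
  have hcs : ∀ n, HasCompactSupport (η n) := fun n =>
    isCompact_Icc.of_isClosed_subset (isClosed_tsupport _) (hts n)
  have hsm : ∀ n, ContDiff ℝ ∞ (η n) := fun n =>
    ((φ n).contDiff_primitive.comp (contDiff_id.sub contDiff_const)).sub
      ((φ n).contDiff_primitive.comp (contDiff_id.sub contDiff_const))
  have hηd0 : ∀ n, ∀ t ∉ K, deriv (η n) t = 0 := fun n t ht =>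
    image_eq_zero_of_notMem_tsupport fun hc =>
      ht (hts n ((tsupport_deriv_subset (𝕜 := ℝ)) hc))
  have hconv : ∀ (q : ℝ → ℝ) (v v1 : ℝ → ℂ), (∀ t ∉ K, q t = 0) → (∀ t ∈ K, v1 t = v t) →
      ∫ t in I, q t • v t = ∫ t, q t • v1 t := by
    intro q v v1 hq hv
    rw [setIntegral_eq_integral_of_forall_compl_eq_zero]
    · refine integral_congr_ae (.of_forall fun t => ?_)
      by_cases ht : t ∈ K
      · simp only [hv t ht]
      · simp [hq t ht]
    · intro t ht
      rw [hq t fun hc => ht (hKI hc), zero_smul]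
  have hmain : ∀ n, (∫ t, (φ n).normed volume (t - x) • u1 t) -
      ∫ t, (φ n).normed volume (t - y) • u1 t = -∫ t, η n t • g1 t := by
    intro n
    have h1 := h (η n) (hsm n) (hcs n) ((hts n).trans hsub)
    rw [hconv _ u u1 (hηd0 n) hu1e, hconv _ g g1 (hη0 n) fun t ht => indicator_of_mem ht g] at h1
    rw [← h1, ← integral_sub]
    · refine integral_congr_ae (.of_forall fun t => ?_)
      simp only [(hηd n t).deriv, sub_smul]
    · exact integrable_normed_bump_smul (φ n) hu1c x
    · exact integrable_normed_bump_smul (φ n) hu1c y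
  have hlim1 : Tendsto (fun n => (∫ t, (φ n).normed volume (t - x) • u1 t) -
      ∫ t, (φ n).normed volume (t - y) • u1 t) atTop (𝓝 (u1 x - u1 y)) :=
    (tendsto_integral_normed_bump_smul hφ hu1c x).sub (tendsto_integral_normed_bump_smul hφ hu1c y)
  have hlim2 : Tendsto (fun n => ∫ t, η n t • g1 t) atTop (𝓝 (∫ t, (Ioc x y).indicator g1 t)) := by
    refine tendsto_integral_of_dominated_convergence (fun t => ‖g1 t‖)
      (fun n => (hsm n).continuous.aestronglyMeasurable.smul hg1i.aestronglyMeasurable)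
      hg1i.norm (fun n => .of_forall fun t => ?_) ?_
    · rw [norm_smul]
      refine mul_le_of_le_one_left (norm_nonneg _) ?_
      have h1 := (φ n).primitive_mem_Icc (t - x)
      have h2 := (φ n).primitive_mem_Icc (t - y)
      rw [Real.norm_eq_abs, abs_le]
      constructor <;> linarith [h1.1, h1.2, h2.1, h2.2]
    · have hne : ∀ᵐ t : ℝ, t ≠ x ∧ t ≠ y := by
        have h1 : ∀ z : ℝ, ∀ᵐ t : ℝ, t ≠ z := fun z => by simp [ae_iff, measure_singleton]
        exact (h1 x).and (h1 y)
      filter_upwards [hne] with t ht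
      have hsmall : ∀ c : ℝ, 0 < c → ∀ᶠ n in atTop, (φ n).rOut ≤ c := fun c hc =>
        hφ.eventually_le_const hc
      rcases lt_or_gt_of_ne ht.1 with h1 | h1
      · refine tendsto_const_nhds.congr' ?_
        filter_upwards [hsmall (x - t) (by linarith)] with n hn
        rw [indicator_of_notMem (fun hc => absurd hc.1 (by linarith))]
        simp only [η]
        rw [ContDiffBump.primitive_of_le _ (by linarith),
          ContDiffBump.primitive_of_le _ (by linarith), sub_zero, zero_smul]
      · rcases lt_or_gt_of_ne ht.2 with h2 | h2
        · refine tendsto_const_nhds.congr' ?_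
          filter_upwards [hsmall (t - x) (by linarith), hsmall (y - t) (by linarith)] with n hn hn'
          have htm : t ∈ Ioc x y := ⟨h1, h2.le⟩
          rw [indicator_of_mem htm]
          simp only [η]
          rw [ContDiffBump.primitive_of_ge _ (by linarith),
            ContDiffBump.primitive_of_le _ (by linarith), sub_zero, one_smul]
        · refine tendsto_const_nhds.congr' ?_
          filter_upwards [hsmall (t - y) (by linarith)] with n hn
          rw [indicator_of_notMem (fun hc => absurd hc.2 (by linarith))]
          simp only [η]
          rw [ContDiffBump.primitive_of_ge _ (by linarith),
            ContDiffBump.primitive_of_ge _ (by linarith), sub_self, zero_smul]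
  have heq := tendsto_nhds_unique hlim1 ((hlim2.neg).congr fun n => (hmain n).symm)
  rw [integral_indicator measurableSet_Ioc] at heq
  have hxK : x ∈ K := ⟨by linarith, by linarith⟩
  have hyK : y ∈ K := ⟨by linarith, by linarith⟩
  rw [hu1e x hxK, hu1e y hyK] at heq
  have hsubK : ∫ t in Ioc x y, g1 t = ∫ t in Ioc x y, g t :=
    setIntegral_congr_fun measurableSet_Ioc fun t ht => by
      have htK : t ∈ K := ⟨by linarith [ht.1], by linarith [ht.2]⟩
      simp only [g1, indicator_of_mem htK]
  rw [intervalIntegral.integral_of_le hxy, ← hsubK, ← neg_sub, heq, neg_neg]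

end weak

/-! ### Functions on the graph and the lower bound. -/

namespace MetricGraph

open Filter Topology

variable {V E : Type*} {G : MetricGraph V E}

theorem ordConnected_interval (G : MetricGraph V E) (e : E) : (G.interval e).OrdConnected :=
  ⟨fun _ hx _ hy _ hz => ⟨hx.1.trans hz.1, (ENNReal.ofReal_le_ofReal hz.2).trans hy.2⟩⟩

theorem isClosed_interval (G : MetricGraph V E) (e : E) : IsClosed (G.interval e) := by
  by_cases h : G.length e = ⊤
  · rw [G.interval_of_eq_top h]; exact isClosed_Ici
  · rw [G.interval_of_ne_top h]; exact isClosed_Icc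

theorem measurableSet_interval (G : MetricGraph V E) (e : E) : MeasurableSet (G.interval e) :=
  (G.isClosed_interval e).measurableSet

theorem zero_mem_interval (G : MetricGraph V E) (e : E) : (0 : ℝ) ∈ G.interval e := by
  simp [interval]

/-- Weak derivatives carry information only in the interior, which is empty for an edge of length
zero; otherwise the ends are recovered by continuity. -/
theorem interval_eq_singleton_or_closure_interior (G : MetricGraph V E) (e : E) :
    G.interval e = {0} ∨ closure (interior (G.interval e)) = G.interval e := by
  by_cases h : G.length e = ⊤
  · right; rw [G.interval_of_eq_top h, interior_Ici, closure_Ioi]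
  · rw [G.interval_of_ne_top h]
    rcases (ENNReal.toReal_nonneg (a := G.length e)).eq_or_lt with h0 | h0
    · left; rw [← h0, Icc_self]
    · right; rw [interior_Icc, closure_Ioo h0.ne]

namespace H1Function

variable (u : G.H1Function) (e : E)

theorem integrable_sq_toFun : IntegrableOn (fun x => ‖u.toFun e x‖ ^ 2) (G.interval e) :=
  (memLp_two_iff_integrable_sq_norm (u.memLp_toFun e).1).1 (u.memLp_toFun e)

theorem integrable_sq_weakDeriv : IntegrableOn (fun x => ‖u.weakDeriv e x‖ ^ 2) (G.interval e) :=
  (memLp_two_iff_integrable_sq_norm (u.memLp_weakDeriv e).1).1 (u.memLp_weakDeriv e)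

theorem integrableOn_weakDeriv {a b : ℝ} (h : Icc a b ⊆ G.interval e) :
    IntegrableOn (u.weakDeriv e) (Icc a b) :=
  ((u.memLp_weakDeriv e).mono_measure (Measure.restrict_mono h le_rfl)).integrable one_le_two

theorem norm_sub_le {x y : ℝ} (hxy : x ≤ y) (hx : x ∈ interior (G.interval e))
    (hy : y ∈ interior (G.interval e)) :
    |‖u.toFun e y‖ - ‖u.toFun e x‖| ≤ ∫ t in x..y, ‖u.weakDeriv e t‖ := by
  refine (abs_norm_sub_norm_le _ _).trans ?_
  rw [(u.isWeakDerivOn e).sub_eq_integral (G.ordConnected_interval e) (u.continuousOn e)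
    (fun a b h => u.integrableOn_weakDeriv e h) hxy hx hy]
  exact intervalIntegral.norm_integral_le_integral_norm hxy

/-- On a halfline, `|u|` drops by at most `D` from `y` over `[y, y + 1]`, while its mean there is at
most `B`; both bounds come from `s ≤ (1 + s²) / 2` and do not depend on `y`. -/
theorem exists_norm_le : ∃ C, ∀ x ∈ G.interval e, ‖u.toFun e x‖ ≤ C := by
  by_cases h : G.length e = ⊤
  · have hI := G.interval_of_eq_top h
    have h2 := u.integrable_sq_toFun e
    have h3 := u.integrable_sq_weakDeriv e
    set D := (1 + ∫ x in G.interval e, ‖u.weakDeriv e x‖ ^ 2) / 2 with hD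
    set B := (1 + ∫ x in G.interval e, ‖u.toFun e x‖ ^ 2) / 2 with hB
    have half : ∀ (v : ℝ → ℂ), IntegrableOn (fun x => ‖v x‖ ^ 2) (G.interval e) → ∀ y, 0 < y →
        IntegrableOn v (Icc y (y + 1)) →
        ∫ x in y..(y + 1), ‖v x‖ ≤ (1 + ∫ x in G.interval e, ‖v x‖ ^ 2) / 2 := by
      intro v hv y hy hvi
      have hsub : Ioc y (y + 1) ⊆ G.interval e := by
        rw [hI]; intro z hz; exact hy.le.trans hz.1.le
      rw [intervalIntegral.integral_of_le (by linarith)]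
      calc ∫ x in Ioc y (y + 1), ‖v x‖ ≤ ∫ x in Ioc y (y + 1), (1 / 2 + 1 / 2 * ‖v x‖ ^ 2) := by
            refine integral_mono (hvi.mono_set Ioc_subset_Icc_self).norm
              ((integrable_const _).add ((hv.mono_set hsub).const_mul _)) fun x => ?_
            simp only
            nlinarith [sq_nonneg (‖v x‖ - 1)]
        _ = (1 + ∫ x in Ioc y (y + 1), ‖v x‖ ^ 2) / 2 := by
            rw [integral_add (integrable_const _) ((hv.mono_set hsub).const_mul _),
              integral_const_mul]
            simp
            ring
        _ ≤ _ := by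
            have := setIntegral_mono_set hv (.of_forall fun x => by positivity)
              (LE.le.eventuallyLE hsub)
            linarith
    have hint : ∀ y : ℝ, 0 < y → y ∈ interior (G.interval e) := fun y hy => by
      rw [hI, interior_Ici]; exact hy
    have hloc : ∀ y : ℝ, 0 < y → Icc y (y + 1) ⊆ G.interval e := fun y hy z hz => by
      rw [hI]; exact hy.le.trans hz.1
    have hbd : ∀ y : ℝ, 0 < y → ‖u.toFun e y‖ ≤ B + D := by
      intro y hy
      have huc : ContinuousOn (u.toFun e) (Icc y (y + 1)) := (u.continuousOn e).mono (hloc y hy)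
      have hD' := half _ h3 y hy (u.integrableOn_weakDeriv e (hloc y hy))
      have hB' := half _ h2 y hy huc.integrableOn_Icc
      have hgi : IntervalIntegrable (fun t => ‖u.weakDeriv e t‖) volume y (y + 1) :=
        (intervalIntegrable_iff_integrableOn_Icc_of_le (by linarith)).2
          (u.integrableOn_weakDeriv e (hloc y hy)).norm
      have hpt : ∀ x ∈ Icc y (y + 1), ‖u.toFun e y‖ - D ≤ ‖u.toFun e x‖ := by
        intro x hx
        have h4 := (abs_le.1 (u.norm_sub_le e hx.1 (hint y hy) (hint x (hy.trans_le hx.1)))).1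
        have h5 : ∫ t in y..x, ‖u.weakDeriv e t‖ ≤ ∫ t in y..(y + 1), ‖u.weakDeriv e t‖ :=
          intervalIntegral.integral_mono_interval le_rfl hx.1 hx.2
            (.of_forall fun t => norm_nonneg _) hgi
        linarith
      have h6 : ∫ x in y..(y + 1), (‖u.toFun e y‖ - D) ≤ ∫ x in y..(y + 1), ‖u.toFun e x‖ := by
        refine intervalIntegral.integral_mono_on (by linarith) (by simp) ?_ hpt
        exact ContinuousOn.intervalIntegrable_of_Icc (by linarith) huc.norm
      rw [intervalIntegral.integral_const] at h6
      simp only [add_sub_cancel_left, one_smul] at h6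
      linarith
    refine ⟨max ‖u.toFun e 0‖ (B + D), fun x hx => ?_⟩
    rw [hI] at hx
    rcases (mem_Ici.1 hx).eq_or_lt with rfl | hx
    · exact le_max_left _ _
    · exact (hbd x hx).trans (le_max_right _ _)
  · have hc := u.continuousOn e
    rw [G.interval_of_ne_top h] at hc ⊢
    exact isCompact_Icc.exists_bound_of_continuousOn hc

theorem exists_norm_lt (he : G.length e = ⊤) {c : ℝ} (hc : 0 < c) :
    ∃ x ∈ G.interval e, ‖u.toFun e x‖ < c := by
  by_contra! hcon
  have h := u.integrable_sq_toFun e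
  have hI : IntegrableOn (fun _ => c ^ 2) (G.interval e) := by
    refine h.mono' aestronglyMeasurable_const ?_
    refine (ae_restrict_iff' (G.measurableSet_interval e)).2 (.of_forall fun x hx => ?_)
    rw [Real.norm_of_nonneg (sq_nonneg c)]
    have := hcon x hx
    gcongr
  rw [integrableOn_const_iff, G.interval_of_eq_top he] at hI
  simp [hc.ne'] at hI

theorem continuousOn_norm : ContinuousOn (fun x => ‖u.toFun e x‖) (G.interval e) :=
  (u.continuousOn e).norm

/-- On a connected noncompact graph, `|u|` attains all positive values below any of its values. -/
theorem exists_norm_eq (hconn : G.Connected) (hnc : G.Noncompact) {e₀ : E} {x₀ c : ℝ}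
    (hx₀ : x₀ ∈ G.interval e₀) (hc : 0 < c) (hcx : c < ‖u.toFun e₀ x₀‖) :
    ∃ e, ∃ x ∈ G.interval e, ‖u.toFun e x‖ = c := by
  by_contra! hcon
  -- If the value `c` is avoided, then `|u| > c` holds on a whole edge or nowhere on it.
  have hside : ∀ e, ∀ x ∈ G.interval e, ∀ y ∈ G.interval e,
      c < ‖u.toFun e x‖ → c < ‖u.toFun e y‖ := by
    intro e x hx y hy hcx
    by_contra! hy'
    have hpre : IsPreconnected (G.interval e) := (G.ordConnected_interval e).isPreconnected
    obtain ⟨z, hz, hzc⟩ := hpre.intermediate_value hy hx (u.continuousOn_norm e) ⟨hy', hcx.le⟩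
    exact hcon e z hz hzc
  obtain ⟨val, hval⟩ := u.continuous_vertex
  -- Vertices at infinity count as lying below `c`, which is consistent because `|u|` gets below `c`
  -- on every halfline. The property then propagates along chains of edges and contradicts
  -- noncompactness.
  have hstep : ∀ a b, (∃ e, G.src e = a ∧ G.tgt e = b) →
      ((a ∉ G.atInfinity ∧ c < ‖val a‖) ↔ (b ∉ G.atInfinity ∧ c < ‖val b‖)) := by
    rintro a b ⟨e, rfl, rfl⟩
    have hs := G.src_notMem_atInfinity e
    by_cases he : G.length e = ⊤
    · have ht := (G.length_eq_top_iff e).1 he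
      obtain ⟨x, hx, hxc⟩ := u.exists_norm_lt e he hc
      simp only [hs, ht, not_true_eq_false, not_false_eq_true, true_and, false_and, iff_false,
        not_lt]
      rw [← (hval e).1]
      by_contra! hlt
      exact absurd (hside e 0 (G.zero_mem_interval e) x hx hlt) (not_lt.2 hxc.le)
    · have ht : G.tgt e ∉ G.atInfinity := fun h => he ((G.length_eq_top_iff e).2 h)
      have hl : (G.length e).toReal ∈ G.interval e := by
        rw [G.interval_of_ne_top he]; exact right_mem_Icc.2 ENNReal.toReal_nonneg
      simp only [hs, ht, not_false_eq_true, true_and]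
      rw [← (hval e).1, ← (hval e).2 he]
      exact ⟨hside e _ (G.zero_mem_interval e) _ hl, hside e _ hl _ (G.zero_mem_interval e)⟩
  have hall : ∀ a b, Relation.EqvGen (fun a b => ∃ e, G.src e = a ∧ G.tgt e = b) a b →
      ((a ∉ G.atInfinity ∧ c < ‖val a‖) ↔ (b ∉ G.atInfinity ∧ c < ‖val b‖)) := by
    intro a b hab
    induction hab with
    | rel a b h => exact hstep a b h
    | refl a => rfl
    | symm a b _ ih => exact ih.symm
    | trans a b c _ _ ih1 ih2 => exact ih1.trans ih2
  obtain ⟨v, hv⟩ := hnc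
  refine ((hall (G.src e₀) v (hconn _ _)).1 ⟨G.src_notMem_atInfinity e₀, ?_⟩).1 hv
  rw [← (hval e₀).1]
  exact hside e₀ x₀ hx₀ 0 (G.zero_mem_interval e₀) hcx

/-- The range over an edge of a primitive of `h` composed with `|u|`. -/
theorem volume_image_primitive_norm_le {h : ℝ → ℝ} (hh : Continuous h) (h0 : ∀ s, 0 ≤ h s)
    (hi : IntegrableOn (fun x => h ‖u.toFun e x‖ * ‖u.weakDeriv e x‖) (G.interval e)) :
    volume ((fun x => ∫ s in (0 : ℝ)..‖u.toFun e x‖, h s) '' G.interval e) ≤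
      ENNReal.ofReal (∫ x in G.interval e, h ‖u.toFun e x‖ * ‖u.weakDeriv e x‖) := by
  rcases G.interval_eq_singleton_or_closure_interior e with hI | hI
  · rw [hI]; simp
  set H : ℝ → ℝ := fun t => ∫ s in (0 : ℝ)..t, h s with hHdef
  have hH : Continuous H := intervalIntegral.continuous_primitive
    (fun a b => hh.intervalIntegrable a b) 0
  have hcont : ContinuousOn (fun x => H ‖u.toFun e x‖) (closure (interior (G.interval e))) := by
    rw [hI]; exact hH.comp_continuousOn (u.continuousOn_norm e)
  have himg := hcont.image_closure
  rw [hI] at himg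
  -- Measure is at most diameter, and passing to the closure does not change the diameter, so
  -- interior points suffice.
  refine (measure_mono himg).trans ((Real.volume_le_diam _).trans ?_)
  rw [Metric.ediam_closure]
  have key : ∀ x ∈ interior (G.interval e), ∀ y ∈ interior (G.interval e), x ≤ y →
      |H ‖u.toFun e y‖ - H ‖u.toFun e x‖| ≤
        ∫ x in G.interval e, h ‖u.toFun e x‖ * ‖u.weakDeriv e x‖ := by
    intro x hx y hy hxy
    have hsubi : Icc x y ⊆ interior (G.interval e) := (G.ordConnected_interval e).interior.out hx hy
    have hsub : Icc x y ⊆ G.interval e := hsubi.trans interior_subset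
    have hg : IntervalIntegrable (fun t => ‖u.weakDeriv e t‖) volume x y :=
      (intervalIntegrable_iff_integrableOn_Icc_of_le hxy).2 (u.integrableOn_weakDeriv e hsub).norm
    have h1 := abs_intervalIntegral_le_of_abs_sub_le (w := fun x => ‖u.toFun e x‖) hxy hg
      (fun _ => norm_nonneg _) (fun s hs t ht hst => u.norm_sub_le e hst (hsubi hs) (hsubi ht))
      hh h0
    have h2 : H ‖u.toFun e y‖ - H ‖u.toFun e x‖ =
        ∫ s in ‖u.toFun e x‖..‖u.toFun e y‖, h s :=
      intervalIntegral.integral_interval_sub_left (hh.intervalIntegrable _ _)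
        (hh.intervalIntegrable _ _)
    rw [h2]
    refine h1.trans ?_
    rw [intervalIntegral.integral_of_le hxy]
    exact setIntegral_mono_set hi (.of_forall fun t => mul_nonneg (h0 _) (norm_nonneg _))
      (LE.le.eventuallyLE (Ioc_subset_Icc_self.trans hsub))
  refine Metric.ediam_le ?_
  rintro _ ⟨x, hx, rfl⟩ _ ⟨y, hy, rfl⟩
  rw [edist_dist, Real.dist_eq]
  refine ENNReal.ofReal_le_ofReal ?_
  rcases le_total x y with hxy | hxy
  · rw [abs_sub_comm]; exact key x hx y hy hxy
  · exact key y hy x hx hxy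

/-- By `exists_norm_eq` the images of the edges under `H ∘ |u|` cover `(0, H |u x₀|)`, so its length
is at most the sum of their measures. -/
theorem primitive_le_sum_integral [Fintype E] (hconn : G.Connected) (hnc : G.Noncompact)
    {h : ℝ → ℝ} (hh : Continuous h) (h0 : ∀ s, 0 ≤ h s)
    (hi : ∀ e, IntegrableOn (fun x => h ‖u.toFun e x‖ * ‖u.weakDeriv e x‖) (G.interval e))
    {x₀ : ℝ} (hx₀ : x₀ ∈ G.interval e) :
    ∫ s in (0 : ℝ)..‖u.toFun e x₀‖, h s ≤
      ∑ e, ∫ x in G.interval e, h ‖u.toFun e x‖ * ‖u.weakDeriv e x‖ := by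
  set H : ℝ → ℝ := fun t => ∫ s in (0 : ℝ)..t, h s with hHdef
  have hH : Continuous H := intervalIntegral.continuous_primitive
    (fun a b => hh.intervalIntegrable a b) 0
  have hA : ∀ e, 0 ≤ ∫ x in G.interval e, h ‖u.toFun e x‖ * ‖u.weakDeriv e x‖ := fun e =>
    integral_nonneg fun x => mul_nonneg (h0 _) (norm_nonneg _)
  have hsub : Ioo 0 (H ‖u.toFun e x₀‖) ⊆
      ⋃ e, (fun x => H ‖u.toFun e x‖) '' G.interval e := by
    have h1 := intermediate_value_Ioo (norm_nonneg (u.toFun e x₀)) hH.continuousOn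
    have hH0 : H 0 = 0 := intervalIntegral.integral_same
    rw [hH0] at h1
    intro c hc
    obtain ⟨t, ht, rfl⟩ := h1 hc
    obtain ⟨e', x, hx, hxt⟩ := u.exists_norm_eq hconn hnc hx₀ ht.1 ht.2
    exact mem_iUnion.2 ⟨e', x, hx, by simp only [hxt]⟩
  have hvol := (measure_mono hsub).trans (measure_iUnion_fintype_le volume _)
  rw [Real.volume_Ioo, sub_zero] at hvol
  have h2 := hvol.trans (Finset.sum_le_sum fun e _ =>
    u.volume_image_primitive_norm_le e hh h0 (hi e))
  rw [← ENNReal.ofReal_sum_of_nonneg fun e _ => hA e] at h2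
  exact (ENNReal.ofReal_le_ofReal_iff (Finset.sum_nonneg fun e _ => hA e)).1 h2

theorem exists_sup_norm [Fintype E] (hu : 0 < u.mass) :
    ∃ M, 0 < M ∧ (∀ e, ∀ x ∈ G.interval e, ‖u.toFun e x‖ ≤ M) ∧
      ∀ m < M, ∃ e, ∃ x ∈ G.interval e, m < ‖u.toFun e x‖ := by
  choose C hC using u.exists_norm_le
  set S : Set ℝ := {r | ∃ e, ∃ x ∈ G.interval e, ‖u.toFun e x‖ = r} with hS
  have hbdd : BddAbove S := by
    refine ⟨∑ e, |C e|, ?_⟩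
    rintro _ ⟨e, x, hx, rfl⟩
    exact (hC e x hx).trans ((le_abs_self _).trans
      (Finset.single_le_sum (f := fun e => |C e|) (fun e _ => abs_nonneg _) (Finset.mem_univ e)))
  obtain ⟨e, x, hx, hpos⟩ : ∃ e, ∃ x ∈ G.interval e, 0 < ‖u.toFun e x‖ := by
    by_contra! hcon
    refine hu.ne' (Finset.sum_eq_zero fun e _ => ?_)
    refine setIntegral_eq_zero_of_forall_eq_zero fun x hx => ?_
    rw [le_antisymm (hcon e x hx) (norm_nonneg _)]
    simp
  refine ⟨sSup S, hpos.trans_le (le_csSup hbdd ⟨e, x, hx, rfl⟩),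
    fun e x hx => le_csSup hbdd ⟨e, x, hx, rfl⟩, fun m hm => ?_⟩
  obtain ⟨_, ⟨e, x, hx, rfl⟩, hlt⟩ := exists_lt_of_lt_csSup (s := S)
    ⟨‖u.toFun e x‖, e, x, hx, rfl⟩ hm
  exact ⟨e, x, hx, hlt⟩

theorem integrable_rpow_norm {p M : ℝ} (hp : 2 < p)
    (hle : ∀ x ∈ G.interval e, ‖u.toFun e x‖ ≤ M) :
    IntegrableOn (fun x => ‖u.toFun e x‖ ^ p) (G.interval e) := by
  refine ((u.integrable_sq_toFun e).const_mul (M ^ (p - 2))).mono' ?_ ?_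
  · exact ((u.continuousOn_norm e).rpow_const fun x _ => Or.inr (by linarith)).aestronglyMeasurable
      (G.measurableSet_interval e)
  · refine (ae_restrict_iff' (G.measurableSet_interval e)).2 (.of_forall fun x hx => ?_)
    rw [Real.norm_of_nonneg (by positivity)]
    have h1 : ‖u.toFun e x‖ ^ p = ‖u.toFun e x‖ ^ (p - 2) * ‖u.toFun e x‖ ^ 2 := by
      rcases (norm_nonneg (u.toFun e x)).eq_or_lt with h | h
      · rw [← h, Real.zero_rpow (by linarith)]; simp
      · rw [← Real.rpow_two, ← Real.rpow_add h]; ring_nf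
    rw [h1]
    gcongr
    exact hle x hx

/-- `M` is the supremum of `|u|`. The coefficient of `s²` in `F` is the least one making `F ≥ 0` on
`[0, M]`, and `2ab ≤ a² + b²` is applied to `√F(|u|)` and `|u'|`. -/
theorem exists_halfSolitonAction_le [Fintype E] (hconn : G.Connected) (hnc : G.Noncompact)
    {p : ℝ} (hp : 2 < p) (hu : 0 < u.mass) :
    ∃ M, 0 < M ∧ halfSolitonAction p M ≤ u.energy p + 1 / p * M ^ (p - 2) * u.mass := by
  obtain ⟨M, hM, hle, hsup⟩ := u.exists_sup_norm hu
  refine ⟨M, hM, ?_⟩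
  have hp0 : 0 < p := by linarith
  set F : ℝ → ℝ := fun s => 2 / p * M ^ (p - 2) * s ^ 2 - 2 / p * s ^ p with hF
  have hFc : Continuous F := by
    have := Real.continuous_rpow_const hp0.le
    fun_prop
  have hFnn : ∀ s, 0 ≤ s → s ≤ M → 0 ≤ F s := by
    intro s hs hsM
    have h1 : s ^ p = s ^ (p - 2) * s ^ 2 := by
      rcases hs.eq_or_lt with h | h
      · rw [← h, Real.zero_rpow (by linarith)]; simp
      · rw [← Real.rpow_two, ← Real.rpow_add h]; ring_nf
    have h2 : s ^ (p - 2) ≤ M ^ (p - 2) := Real.rpow_le_rpow hs hsM (by linarith)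
    have h3 : F s = 2 / p * s ^ 2 * (M ^ (p - 2) - s ^ (p - 2)) := by
      simp only [hF]; rw [h1]; ring
    rw [h3]
    have := sub_nonneg.2 h2
    positivity
  set h : ℝ → ℝ := fun s => √(F s) with hh
  have hhc : Continuous h := hFc.sqrt
  have h0 : ∀ s, 0 ≤ h s := fun s => Real.sqrt_nonneg _
  have hFi : ∀ e, IntegrableOn (fun x => F ‖u.toFun e x‖) (G.interval e) := fun e =>
    ((u.integrable_sq_toFun e).const_mul _).sub ((u.integrable_rpow_norm e hp (hle e)).const_mul _)
  have hbi : ∀ e, IntegrableOn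
      (fun x => 1 / 2 * (‖u.weakDeriv e x‖ ^ 2 + F ‖u.toFun e x‖)) (G.interval e) := fun e =>
    ((u.integrable_sq_weakDeriv e).add (hFi e)).const_mul _
  have hpt : ∀ e, ∀ x ∈ G.interval e, h ‖u.toFun e x‖ * ‖u.weakDeriv e x‖ ≤
      1 / 2 * (‖u.weakDeriv e x‖ ^ 2 + F ‖u.toFun e x‖) := by
    intro e x hx
    have h1 := Real.sq_sqrt (hFnn _ (norm_nonneg _) (hle e x hx))
    have h2 := two_mul_le_add_sq (h ‖u.toFun e x‖) ‖u.weakDeriv e x‖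
    simp only [hh] at h2 ⊢
    rw [h1] at h2
    linarith
  have hi : ∀ e, IntegrableOn (fun x => h ‖u.toFun e x‖ * ‖u.weakDeriv e x‖) (G.interval e) := by
    intro e
    refine (hbi e).mono' ?_ ?_
    · exact ((hhc.comp_continuousOn (u.continuousOn_norm e)).aestronglyMeasurable
        (G.measurableSet_interval e)).mul (u.memLp_weakDeriv e).1.norm
    · refine (ae_restrict_iff' (G.measurableSet_interval e)).2 (.of_forall fun x hx => ?_)
      rw [Real.norm_of_nonneg (mul_nonneg (h0 _) (norm_nonneg _))]
      exact hpt e x hx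
  have hHc : Continuous fun t => ∫ s in (0 : ℝ)..t, h s := intervalIntegral.continuous_primitive
    (fun a b => hhc.intervalIntegrable a b) 0
  have hHM : halfSolitonAction p M ≤
      ∑ e, ∫ x in G.interval e, h ‖u.toFun e x‖ * ‖u.weakDeriv e x‖ := by
    -- The supremum `M` is not known to be attained, so `m ↑ M` is used with continuity of the
    -- primitive.
    refine le_of_tendsto ((hHc.tendsto M).mono_left (nhdsWithin_le_nhds (s := Iio M))) ?_
    filter_upwards [Ioo_mem_nhdsLT hM] with m hm
    obtain ⟨e, x, hx, hmx⟩ := hsup m hm.2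
    refine le_trans ?_ (u.primitive_le_sum_integral e hconn hnc hhc h0 hi hx)
    exact intervalIntegral.integral_mono_interval le_rfl hm.1.le hmx.le
      (.of_forall fun s => h0 s) (hhc.intervalIntegrable _ _)
  refine hHM.trans ?_
  have hedge : ∀ e, ∫ x in G.interval e, h ‖u.toFun e x‖ * ‖u.weakDeriv e x‖ ≤
      energyOn p (G.interval e) (u.toFun e) (u.weakDeriv e) +
        1 / p * M ^ (p - 2) * ∫ x in G.interval e, ‖u.toFun e x‖ ^ 2 := by
    intro e
    refine (setIntegral_mono_on (hi e) (hbi e) (G.measurableSet_interval e) (hpt e)).trans_eq ?_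
    rw [integral_const_mul, integral_add (u.integrable_sq_weakDeriv e) (hFi e), hF]
    simp only
    rw [integral_sub ((u.integrable_sq_toFun e).const_mul _)
      ((u.integrable_rpow_norm e hp (hle e)).const_mul _), integral_const_mul,
      integral_const_mul, energyOn]
    ring
  refine (Finset.sum_le_sum fun e _ => hedge e).trans_eq ?_
  rw [Finset.sum_add_distrib, ← Finset.mul_sum]
  rfl

end H1Function

theorem energyOn_soliton_le_groundStateLevel [Fintype E] (hconn : G.Connected)
    (hnc : G.Noncompact) {p μ : ℝ} (hp : 2 < p) (hp6 : p < 6) (hμ : 0 < μ) :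
    (energyOn p (Ici 0) (soliton p (2 * μ)) (deriv (soliton p (2 * μ))) : EReal)
      ≤ G.groundStateLevel p μ := by
  refine le_iInf₂ fun u hu => EReal.coe_le_coe_iff.2 ?_
  obtain ⟨M, hM, hle⟩ := u.exists_halfSolitonAction_le hconn hnc hp (hu ▸ hμ)
  rw [hu] at hle
  linarith [energyOn_soliton_le hp hp6 hμ hM]

end MetricGraph

/-! ### The upper bound: solitons escaping along a halfline. -/

section upper_bound

open Filter Topology

/-- Integration by parts: a `C¹` function on the halfline has its derivative as weak derivative. -/
theorem isWeakDerivOn_Ici_of_hasDerivAt {f f' : ℝ → ℝ} (hf : ∀ x, HasDerivAt f (f' x) x)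
    (hf' : Continuous f') :
    IsWeakDerivOn (Ici 0) (fun x => (f x : ℂ)) (fun x => (f' x : ℂ)) := by
  intro η hη hηc hηs
  have hfc : Continuous f := continuous_iff_continuousAt.2 fun x => (hf x).continuousAt
  have hηd : Continuous (deriv η) := hη.continuous_deriv (by simp)
  have hηdc : HasCompactSupport (deriv η) := hηc.deriv
  have hsub : tsupport η ⊆ Ici 0 := hηs.trans interior_subset
  have h1 : ∫ x in Ici (0 : ℝ), deriv η x • (f x : ℂ) = ((∫ x, deriv η x * f x : ℝ) : ℂ) := by
    rw [setIntegral_eq_integral_of_forall_compl_eq_zero, ← integral_complex_ofReal]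
    · simp
    · intro x hx
      rw [image_eq_zero_of_notMem_tsupport fun h => hx (hsub (tsupport_deriv_subset (𝕜 := ℝ) h)),
        zero_smul]
  have h2 : ∫ x in Ici (0 : ℝ), η x • (f' x : ℂ) = ((∫ x, η x * f' x : ℝ) : ℂ) := by
    rw [setIntegral_eq_integral_of_forall_compl_eq_zero, ← integral_complex_ofReal]
    · simp
    · intro x hx
      rw [image_eq_zero_of_notMem_tsupport fun h => hx (hsub h), zero_smul]
  have hparts := integral_mul_deriv_eq_deriv_mul_of_integrable (u := η) (v := f)
    (u' := deriv η) (v' := f')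
    (fun x _ => ((hη.differentiable (by simp)) x).hasDerivAt) (fun x _ => hf x)
    ((hη.continuous.mul hf').integrable_of_hasCompactSupport hηc.mul_right)
    ((hηd.mul hfc).integrable_of_hasCompactSupport hηdc.mul_right)
    ((hη.continuous.mul hfc).integrable_of_hasCompactSupport hηc.mul_right)
  rw [h1, h2, hparts]
  push_cast
  ring

namespace MetricGraph

variable {V E : Type*} {G : MetricGraph V E}

theorem Noncompact.exists_length_eq_top (hnc : G.Noncompact) : ∃ e, G.length e = ⊤ := by
  obtain ⟨v, hv⟩ := hnc
  obtain ⟨e, rfl, _⟩ := G.degree_atInfinity v hv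
  exact ⟨e, (G.length_eq_top_iff e).2 hv⟩

/-- Functions on the halfline vanishing at the origin can be extended by zero to the graph. -/
theorem groundStateLevel_le_energyOn [Fintype E] (hnc : G.Noncompact) {p : ℝ} (hp : p ≠ 0)
    {f f' : ℝ → ℝ} (hf : ∀ x, HasDerivAt f (f' x) x) (hf' : Continuous f') (hf0 : f 0 = 0)
    (h2 : IntegrableOn (fun x => f x ^ 2) (Ici 0)) (h2' : IntegrableOn (fun x => f' x ^ 2) (Ici 0)) :
    G.groundStateLevel p (∫ x in Ici 0, f x ^ 2) ≤ (energyOn p (Ici 0) f f' : EReal) := by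
  classical
  obtain ⟨e₀, he₀⟩ := hnc.exists_length_eq_top
  have hI := G.interval_of_eq_top he₀
  have hfc : Continuous f := continuous_iff_continuousAt.2 fun x => (hf x).continuousAt
  have hL : ∀ {q : ℝ → ℝ}, Continuous q → IntegrableOn (fun x => q x ^ 2) (Ici 0) →
      MemLp (fun x => (q x : ℂ)) 2 (volume.restrict (Ici 0)) := by
    intro q hq hqi
    refine (memLp_two_iff_integrable_sq_norm
      (Complex.continuous_ofReal.comp hq).aestronglyMeasurable).2 ?_
    simpa [IntegrableOn] using hqi
  let u : G.H1Function :=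
    { toFun := fun e x => if e = e₀ then (f x : ℂ) else 0
      weakDeriv := fun e x => if e = e₀ then (f' x : ℂ) else 0
      continuousOn := fun e => by
        by_cases h : e = e₀
        · simp only [h, if_true]
          exact (Complex.continuous_ofReal.comp hfc).continuousOn
        · simp only [h, if_false]
          exact continuousOn_const
      continuous_vertex := ⟨fun _ => 0, fun e => by
        by_cases h : e = e₀
        · subst h; simp [hf0, he₀]
        · simp [h]⟩
      memLp_toFun := fun e => by
        by_cases h : e = e₀
        · simp only [h, if_true, hI]; exact hL hfc h2
        · simp only [h, if_false]; exact MemLp.zero'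
      memLp_weakDeriv := fun e => by
        by_cases h : e = e₀
        · simp only [h, if_true, hI]; exact hL hf' h2'
        · simp only [h, if_false]; exact MemLp.zero'
      isWeakDerivOn := fun e => by
        by_cases h : e = e₀
        · simp only [h, if_true, hI]; exact isWeakDerivOn_Ici_of_hasDerivAt hf hf'
        · simp only [h, if_false]
          intro η _ _ _
          simp }
  have hmass : u.mass = ∫ x in Ici 0, f x ^ 2 := by
    rw [H1Function.mass, Finset.sum_eq_single e₀ (fun e _ h => by simp [u, h]) (by simp), hI]
    simp [u]
  have henergy : u.energy p = energyOn p (Ici 0) f f' := by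
    rw [H1Function.energy, Finset.sum_eq_single e₀
      (fun e _ h => by simp [u, h, energyOn, Real.zero_rpow hp]) (by simp), hI]
    simp [u, energyOn]
  rw [← henergy]
  exact iInf₂_le u hmass

end MetricGraph

/-- Dominated convergence for translates moving to the right on the halfline. -/
theorem tendsto_setIntegral_Ici_comp_sub {F : ℕ → ℝ → ℝ} {L B : ℝ → ℝ}
    (hF : ∀ n, Continuous (F n)) (hB : Integrable B)
    (hle : ∀ n : ℕ, ∀ y : ℝ, 0 ≤ y + n → |F n y| ≤ B y)
    (hlim : ∀ y, Tendsto (fun n => F n y) atTop (𝓝 (L y))) :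
    Tendsto (fun n : ℕ => ∫ x in Ici (0 : ℝ), F n (x - n)) atTop (𝓝 (∫ y, L y)) := by
  have h1 : ∀ n : ℕ, ∫ x in Ici (0 : ℝ), F n (x - n) =
      ∫ y, (Ici (-n : ℝ)).indicator (F n) y := by
    intro n
    rw [← integral_indicator measurableSet_Ici,
      ← integral_sub_right_eq_self ((Ici (-n : ℝ)).indicator (F n)) (n : ℝ)]
    refine integral_congr_ae (.of_forall fun x => ?_)
    simp only [indicator, mem_Ici, neg_le_sub_iff_le_add, le_add_iff_nonneg_left]
  simp_rw [h1]
  -- Every `y` satisfies `0 ≤ y + n` for some `n`, so the bound itself forces `B ≥ 0`.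
  have hB0 : ∀ y, 0 ≤ B y := fun y => by
    obtain ⟨n, hn⟩ := exists_nat_ge (-y)
    exact (abs_nonneg _).trans (hle n y (by linarith))
  refine tendsto_integral_of_dominated_convergence B
    (fun n => (hF n).aestronglyMeasurable.indicator measurableSet_Ici) hB
    (fun n => .of_forall fun y => ?_) (.of_forall fun y => ?_)
  · by_cases hy : y ∈ Ici (-n : ℝ)
    · rw [indicator_of_mem hy]
      exact hle n y (by linarith [mem_Ici.1 hy])
    · rw [indicator_of_notMem hy, norm_zero]
      exact hB0 y
  · refine (hlim y).congr' ?_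
    obtain ⟨N, hN⟩ := exists_nat_ge (-y)
    filter_upwards [eventually_ge_atTop N] with n hn
    rw [indicator_of_mem]
    have : (N : ℝ) ≤ n := by exact_mod_cast hn
    exact mem_Ici.2 (by linarith)

theorem integrableOn_Ici_comp_sub {F B : ℝ → ℝ} {c : ℝ} (hF : Continuous F) (hB : Integrable B)
    (hle : ∀ y : ℝ, 0 ≤ y + c → |F y| ≤ B y) :
    IntegrableOn (fun x => F (x - c)) (Ici 0) := by
  refine (hB.comp_sub_right c).integrableOn.mono' (hF.comp (by fun_prop)).aestronglyMeasurable ?_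
  refine (ae_restrict_iff' measurableSet_Ici).2 (.of_forall fun x hx => hle _ ?_)
  simpa using hx

theorem energyOn_const_mul (p : ℝ) (I : Set ℝ) {s : ℝ} (hs : 0 ≤ s) (f f' : ℝ → ℝ) :
    energyOn p I (fun x => s * f x) (fun x => s * f' x) =
      1 / 2 * (s ^ 2 * ∫ x in I, ‖f' x‖ ^ 2) - 1 / p * (s ^ p * ∫ x in I, ‖f x‖ ^ p) := by
  simp_rw [energyOn, norm_mul, Real.norm_of_nonneg hs, mul_pow,
    Real.mul_rpow hs (norm_nonneg _), integral_const_mul]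

namespace MetricGraph

variable {V E : Type*} {G : MetricGraph V E}

/-- The competitor is the soliton centered at `n` times `1 - e^(-x)`, a smooth factor vanishing at
`0` with values in `[0, 1)` on the halfline. Multiples of `φ` dominate it and its derivative
uniformly in `n`. -/
theorem groundStateLevel_le_energyOn_soliton [Fintype E] (hnc : G.Noncompact) {p μ : ℝ}
    (hp : 2 < p) (hp6 : p < 6) (hμ : 0 < μ) :
    G.groundStateLevel p μ ≤ (energyOn p univ (soliton p μ) (deriv (soliton p μ)) : EReal) := by
  obtain ⟨A, b, hA, hb, hs, -, hmass⟩ := exists_soliton_eq_sechProfile hp hp6 hμ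
  have h1 : 0 < p - 2 := by linarith
  have hp0 : 0 < p := by linarith
  have hr : 0 < 2 / (p - 2) := by positivity
  rw [hs] at hmass ⊢
  set r := 2 / (p - 2)
  set φ := sechProfile A b r with hφ
  have hφc : Continuous φ := continuous_sechProfile A b r
  have hφ'c : Continuous (deriv φ) := continuous_deriv_sechProfile A b r
  have hφ0 : ∀ x, 0 < φ x := sechProfile_pos hA
  have hφi : ∀ q : ℝ, 0 < q → Integrable fun x => φ x ^ q := fun q hq =>
    integrable_sechProfile_rpow hA hb hr hq
  -- the cutoff profile, in the coordinate centered at the soliton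
  let θ : ℕ → ℝ → ℝ := fun n y => Real.exp (-(y + n))
  have hθc : ∀ n, Continuous (θ n) := fun n => by simp only [θ]; fun_prop
  have hθ : ∀ n : ℕ, ∀ y : ℝ, 0 ≤ y + n → 0 ≤ θ n y ∧ θ n y ≤ 1 := fun n y hy =>
    ⟨(Real.exp_pos _).le, Real.exp_le_one_iff.2 (by linarith)⟩
  have hθlim : ∀ y, Tendsto (fun n => θ n y) atTop (𝓝 0) := fun y =>
    Real.tendsto_exp_neg_atTop_nhds_zero.comp
      (tendsto_atTop_add_const_left _ _ tendsto_natCast_atTop_atTop)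
  let Φ : ℕ → ℝ → ℝ := fun n y => φ y * (1 - θ n y)
  let Φ' : ℕ → ℝ → ℝ := fun n y => deriv φ y * (1 - θ n y) + φ y * θ n y
  have hΦc : ∀ n, Continuous (Φ n) := fun n => hφc.mul (continuous_const.sub (hθc n))
  have hΦ'c : ∀ n, Continuous (Φ' n) := fun n =>
    (hφ'c.mul (continuous_const.sub (hθc n))).add (hφc.mul (hθc n))
  have hΦd : ∀ n y, HasDerivAt (Φ n) (Φ' n y) y := by
    intro n y
    have h2 : HasDerivAt (θ n) (-θ n y) y := by
      have := (((hasDerivAt_id y).add_const (n : ℝ)).neg).exp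
      simpa [θ] using this
    have h3 := (hasDerivAt_sechProfile A b r y).differentiableAt.hasDerivAt.mul (h2.const_sub 1)
    refine h3.congr_deriv ?_
    simp only [Φ', hφ, neg_neg]
  have hΦlim : ∀ y, Tendsto (fun n => Φ n y) atTop (𝓝 (φ y)) := fun y => by
    simpa using ((hθlim y).const_sub 1).const_mul (φ y)
  have hΦ'lim : ∀ y, Tendsto (fun n => Φ' n y) atTop (𝓝 (deriv φ y)) := fun y => by
    simpa using (((hθlim y).const_sub 1).const_mul (deriv φ y)).add ((hθlim y).const_mul (φ y))
  have hΦle : ∀ n : ℕ, ∀ y : ℝ, 0 ≤ y + n → |Φ n y| ≤ φ y := by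
    intro n y hy
    obtain ⟨h2, h3⟩ := hθ n y hy
    rw [abs_of_nonneg (mul_nonneg (hφ0 y).le (by linarith))]
    exact mul_le_of_le_one_right (hφ0 y).le (by linarith)
  have hΦ'le : ∀ n : ℕ, ∀ y : ℝ, 0 ≤ y + n → |Φ' n y| ≤ (r * b + 1) * φ y := by
    intro n y hy
    obtain ⟨h2, h3⟩ := hθ n y hy
    refine (abs_add_le _ _).trans ?_
    rw [abs_mul, abs_mul, abs_of_nonneg h2, abs_of_nonneg (sub_nonneg.2 h3),
      abs_of_pos (hφ0 y), add_mul, one_mul]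
    refine add_le_add ?_ (mul_le_of_le_one_right (hφ0 y).le h3)
    exact (mul_le_of_le_one_right (abs_nonneg _) (by linarith)).trans
      (abs_deriv_sechProfile_le hA hb hr y)
  have hB2 : Integrable fun y => φ y ^ 2 := by
    simpa only [Real.rpow_two] using hφi 2 two_pos
  have hB2' : Integrable fun y => ((r * b + 1) * φ y) ^ 2 := by
    simp_rw [mul_pow]; exact hB2.const_mul _
  have hsq : ∀ {a c : ℝ}, |a| ≤ c → |a ^ 2| ≤ c ^ 2 := fun {a c} h => by
    rw [abs_pow]; gcongr
  have hm : Tendsto (fun n : ℕ => ∫ x in Ici (0 : ℝ), Φ n (x - n) ^ 2) atTop (𝓝 μ) := by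
    rw [← hmass]
    exact tendsto_setIntegral_Ici_comp_sub (F := fun n y => Φ n y ^ 2) (fun n => (hΦc n).pow 2) hB2
      (fun n y hy => hsq (hΦle n y hy)) fun y => (hΦlim y).pow 2
  have hT : Tendsto (fun n : ℕ => ∫ x in Ici (0 : ℝ), ‖Φ' n (x - n)‖ ^ 2) atTop
      (𝓝 (∫ y, ‖deriv φ y‖ ^ 2)) :=
    tendsto_setIntegral_Ici_comp_sub (F := fun n y => ‖Φ' n y‖ ^ 2) (fun n => (hΦ'c n).norm.pow 2)
      hB2' (fun n y hy => hsq (by rw [abs_norm]; exact hΦ'le n y hy)) fun y =>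
      (hΦ'lim y).norm.pow 2
  have hP : Tendsto (fun n : ℕ => ∫ x in Ici (0 : ℝ), ‖Φ n (x - n)‖ ^ p) atTop
      (𝓝 (∫ y, ‖φ y‖ ^ p)) := by
    refine tendsto_setIntegral_Ici_comp_sub (F := fun n y => ‖Φ n y‖ ^ p)
      (fun n => (hΦc n).norm.rpow_const fun y => Or.inr hp0.le) (hφi p hp0) (fun n y hy => ?_)
      fun y => (hΦlim y).norm.rpow_const (Or.inr hp0.le)
    rw [abs_of_nonneg (by positivity)]
    exact Real.rpow_le_rpow (norm_nonneg _) (hΦle n y hy) hp0.le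
  set m : ℕ → ℝ := fun n => ∫ x in Ici (0 : ℝ), Φ n (x - n) ^ 2 with hmdef
  -- The factor restoring mass exactly `μ`; it tends to `1`, so it does not affect the limiting
  -- energy.
  let s : ℕ → ℝ := fun n => √(μ / m n)
  have hslim : Tendsto s atTop (𝓝 1) := by
    have := ((tendsto_const_nhds (x := μ)).div hm hμ.ne').sqrt
    simpa [div_self hμ.ne'] using this
  have hElim : Tendsto (fun n : ℕ => energyOn p (Ici 0) (fun x => s n * Φ n (x - n))
      (fun x => s n * Φ' n (x - n))) atTop (𝓝 (energyOn p univ φ (deriv φ))) := by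
    have hE : ∀ n : ℕ, _ := fun n => energyOn_const_mul p (Ici 0) (Real.sqrt_nonneg (μ / m n))
      (fun x => Φ n (x - n)) (fun x => Φ' n (x - n))
    simp only [s, hE]
    have := (((hslim.pow 2).mul hT).const_mul (1 / 2)).sub
      (((hslim.rpow_const (p := p) (Or.inr hp0.le)).mul hP).const_mul (1 / p))
    simpa [energyOn] using this
  refine ge_of_tendsto ((continuous_coe_real_ereal.tendsto _).comp hElim) ?_
  filter_upwards [hm.eventually (lt_mem_nhds hμ)] with n hn
  have hmass_n : ∫ x in Ici (0 : ℝ), (s n * Φ n (x - n)) ^ 2 = μ := by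
    simp_rw [mul_pow]
    rw [integral_const_mul, Real.sq_sqrt (div_pos hμ hn).le]
    exact div_mul_cancel₀ _ hn.ne'
  have hle := groundStateLevel_le_energyOn (G := G) hnc hp0.ne'
    (f := fun x => s n * Φ n (x - n)) (f' := fun x => s n * Φ' n (x - n))
    (fun x => ((hΦd n (x - n)).comp_sub_const x n).const_mul (s n))
    (continuous_const.mul ((hΦ'c n).comp (by fun_prop))) (by simp [Φ, θ])
    (by simp_rw [mul_pow]
        exact (integrableOn_Ici_comp_sub (F := fun y => Φ n y ^ 2) ((hΦc n).pow 2) hB2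
          fun y hy => hsq (hΦle n y hy)).const_mul _)
    (by simp_rw [mul_pow]
        exact (integrableOn_Ici_comp_sub (F := fun y => Φ' n y ^ 2) ((hΦ'c n).pow 2) hB2'
          fun y hy => hsq (hΦ'le n y hy)).const_mul _)
  rw [hmass_n] at hle
  exact hle

end MetricGraph

end upper_bound

theorem theorem6p1 {V E : Type*} [Finite V] [Fintype E] (G : MetricGraph V E)
    (hconn : G.Connected) (hnoncompact : G.Noncompact)
    (p μ : ℝ) (hp : 2 < p) (hp6 : p < 6) (hμ : 0 < μ) :
    (energyOn p (Ici 0) (soliton p (2 * μ)) (deriv (soliton p (2 * μ))) : EReal)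
        ≤ G.groundStateLevel p μ ∧
      G.groundStateLevel p μ
        ≤ (energyOn p univ (soliton p μ) (deriv (soliton p μ)) : EReal) := by
  exact ⟨MetricGraph.energyOn_soliton_le_groundStateLevel hconn hnoncompact hp hp6 hμ,
    MetricGraph.groundStateLevel_le_energyOn_soliton hnoncompact hp hp6 hμ⟩
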